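/- Let $d\ge 3$, let $|0\rangle,\dots,|d-1\rangle$ be the computational basis of $\mathbb{C}^d$, and let $w_n=e^{2\pi\sqrt{-1}/n}$ and $\mathbb{Z}_n=\{0,1,\dots,n-1\}$. States are not normalized. Let $A,B,C$ be three parties, each holding a system with state space $\mathbb{C}^d$ (joint space $d\otimes d\otimes d$). For an integer $0\le k\le\lfloor\frac{d-3}{2}\rfloor$ put $n=d-1-2k$ and, for $i,j\in\mathbb{Z}_n$, $$|\eta_i\rangle=\sum_{t=k}^{d-2-k}w_n^{i(t-k)}|t\rangle,\qquad |\xi_j\rangle=\sum_{t=k}^{d-2-k}w_n^{j(t-k)}|t+1\rangle .$$ Let $\mathcal{C}^{(d,d-2k)}$ be the set of all states $$|\xi_j\rangle_A|k\rangle_B|\eta_i\rangle_C,\quad |\xi_j\rangle_A|\eta_i\rangle_B|d-1-k\rangle_C,\quad |d-1-k\rangle_A|\xi_j\rangle_B|\eta_i\rangle_C,$$ $$|\eta_i\rangle_A|d-1-k\rangle_B|\xi_j\rangle_C,\quad |\eta_i\rangle_A|\xi_j\rangle_B|k\rangle_C,\quad |k\rangle_A|\eta_i\rangle_B|\xi_j\rangle_C$$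 with $(i,j)\in\mathbb{Z}_n\times\mathbb{Z}_n\setminus\{(0,0)\}$. If $d$ is even, let $$\mathcal{A}^{(d,0)}=\{|\phi_r\rangle_A|\phi_s\rangle_B|\phi_t\rangle_C : (r,s,t)\in\mathbb{Z}_2^3\setminus\{(0,0,0)\}\},\qquad |\phi_r\rangle=|\tfrac{d-2}{2}\rangle+(-1)^r|\tfrac d2\rangle .$$ Let $$|S_d\rangle=\Big(\sum_{i=0}^{d-1}|i\rangle\Big)_A\Big(\sum_{j=0}^{d-1}|j\rangle\Big)_B\Big(\sum_{l=0}^{d-1}|l\rangle\Big)_C .$$ An unextendible product basis (UPB) is a set of mutually orthogonal (nonzero) product states such that the orthogonal complement of its span contains no (nonzero) product state. A POVM $\{E_m=M_m^\dagger M_m\}_m$ with finitely many outcomes, $\sum_m E_m=\mathbb{I}$, performed jointly by a nonempty proper subset $T$ of the parties is orthogonality-preserving for a set of orthogonal states if, for every outcome $m$, the postmeasurement states $(M_m\otimes\mathbb{I})|\psi\rangle$, with $M_m$ acting on the parties in $T$, are mutually orthogonal. It is trivial if every $E_m$ is proportional to the identity. A set of orthogonal product states is of the strongest nonlocality if, in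 each bipartition of the three parties, each of the two sides can perform only trivial orthogonality-preserving POVMs. Then: (i) if $d$ is odd, the set $\bigcup_{k=0}^{(d-3)/2}\mathcal{C}^{(d,d-2k)}\cup\{|S_d\rangle\}$ is a UPB of the strongest nonlocality, and it has $d^3-4d+4$ elements; (ii) if $d$ is even, the set $\bigcup_{k=0}^{(d-4)/2}\mathcal{C}^{(d,d-2k)}\cup\mathcal{A}^{(d,0)}\cup\{|S_d\rangle\}$ is a UPB of the strongest nonlocality, and it has $d^3-4d+8$ elements. -/

import Mathlib

open scoped Matrix

namespace StrongUPB

/-- Pure (unnormalized) states of a system of `d`-level parties indexed by `ι`: the tensor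
product of copies of `ℂ^d` over `ι`, in coordinates with respect to the computational
product basis. -/
abbrev State (ι : Type) [Fintype ι] (d : ℕ) : Type :=
  EuclideanSpace ℂ (ι → Fin d)

/-- The product vector `⨂ p, v p`. -/
noncomputable def productVec {ι : Type} [Fintype ι] {d : ℕ}
    (v : ι → EuclideanSpace ℂ (Fin d)) : State ι d :=
  WithLp.toLp 2 fun x => ∏ p, v p (x p)

/-- A product state: a nonzero product vector. -/
def IsProductState {ι : Type} [Fintype ι] {d : ℕ} (ψ : State ι d) : Prop :=
  ψ ≠ 0 ∧ ∃ v : ι → EuclideanSpace ℂ (Fin d), ψ = productVec v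

/-- The states of the set are mutually orthogonal. -/
def IsOrthogonalSet {ι : Type} [Fintype ι] [DecidableEq ι] {d : ℕ}
    (S : Set (State ι d)) : Prop :=
  S.Pairwise fun ψ φ => inner ℂ ψ φ = 0

/-- Unextendible product basis: a set of mutually orthogonal product states such that the
orthogonal complement of its span contains no product state. -/
def IsUPB {ι : Type} [Fintype ι] [DecidableEq ι] {d : ℕ} (S : Set (State ι d)) : Prop :=
  (∀ ψ ∈ S, IsProductState ψ) ∧ IsOrthogonalSet S ∧
    ∀ ψ ∈ (Submodule.span ℂ S)ᗮ, ¬ IsProductState ψ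

/-- Operators, in the computational basis, on the joint system of the parties in `T`. -/
abbrev LocalOp {ι : Type} (T : Finset ι) (d : ℕ) : Type :=
  Matrix ({p // p ∈ T} → Fin d) ({p // p ∈ T} → Fin d) ℂ

/-- The joint index that agrees with `y` on the parties in `T` and with `x` on the others. -/
def updateOn {ι : Type} [DecidableEq ι] {d : ℕ} (T : Finset ι) (x : ι → Fin d)
    (y : {p // p ∈ T} → Fin d) : ι → Fin d :=
  fun p => if h : p ∈ T then y ⟨p, h⟩ else x p

/-- `(M ⊗ 𝕀) ψ`, where `M` acts on the parties in `T` and the identity on the other ones. -/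
noncomputable def applyLocal {ι : Type} [Fintype ι] [DecidableEq ι] {d : ℕ} (T : Finset ι)
    (M : LocalOp T d) (ψ : State ι d) : State ι d :=
  WithLp.toLp 2 fun x =>
    ∑ y : {p // p ∈ T} → Fin d, M (fun p => x p) y * ψ (updateOn T x y)

/-- The operators `M m` are the measurement operators of a POVM with elements
`E m = (M m)† (M m)`, performed jointly by the parties in `T`. -/
def IsPOVM {ι : Type} [DecidableEq ι] {d : ℕ} (T : Finset ι) {r : ℕ}
    (M : Fin r → LocalOp T d) : Prop :=
  ∑ m, (M m)ᴴ * M m = 1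

/-- For each outcome, the postmeasurement states of the states in `S` are mutually
orthogonal. -/
def IsOrthogonalityPreserving {ι : Type} [Fintype ι] [DecidableEq ι] {d : ℕ}
    (S : Set (State ι d)) (T : Finset ι) {r : ℕ} (M : Fin r → LocalOp T d) : Prop :=
  ∀ m, S.Pairwise fun ψ φ => inner ℂ (applyLocal T (M m) ψ) (applyLocal T (M m) φ) = 0

/-- All POVM elements `(M m)† (M m)` are proportional to the identity. -/
def IsTrivialPOVM {ι : Type} [DecidableEq ι] {d : ℕ} (T : Finset ι) {r : ℕ}
    (M : Fin r → LocalOp T d) : Prop :=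
  ∀ m, ∃ c : ℂ, (M m)ᴴ * M m = c • (1 : LocalOp T d)

/-- The strongest nonlocality: for each bipartition `T | Tᶜ` of the parties, each of the two
sides can only perform trivial orthogonality-preserving POVMs. (`T` runs through all nonempty
proper sets of parties, so both sides of every bipartition are covered.) -/
def HasStrongestNonlocality {ι : Type} [Fintype ι] [DecidableEq ι] {d : ℕ}
    (S : Set (State ι d)) : Prop :=
  ∀ T : Finset ι, T.Nonempty → T ≠ Finset.univ →
    ∀ (r : ℕ) (M : Fin r → LocalOp T d),
      IsPOVM T M → IsOrthogonalityPreserving S T M → IsTrivialPOVM T M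

/-- The computational basis vector `|t⟩` of `ℂ^d` (for `t < d`). -/
noncomputable def ket (d t : ℕ) : EuclideanSpace ℂ (Fin d) :=
  WithLp.toLp 2 fun s => if (s : ℕ) = t then 1 else 0

/-- The root of unity `w_n = exp (2πi/n)`. -/
noncomputable def w (n : ℕ) : ℂ :=
  Complex.exp (2 * Real.pi * Complex.I / n)

/-- `|η_i^{(d-2k)}⟩ = ∑_{t=k}^{d-2-k} w_{d-1-2k}^{i(t-k)} |t⟩`. -/
noncomputable def eta (d k i : ℕ) : EuclideanSpace ℂ (Fin d) :=
  ∑ t ∈ Finset.Icc k (d - 2 - k), w (d - 1 - 2 * k) ^ (i * (t - k)) • ket d t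

/-- `|ξ_j^{(d-2k)}⟩ = ∑_{t=k}^{d-2-k} w_{d-1-2k}^{j(t-k)} |t+1⟩`. -/
noncomputable def xi (d k j : ℕ) : EuclideanSpace ℂ (Fin d) :=
  ∑ t ∈ Finset.Icc k (d - 2 - k), w (d - 1 - 2 * k) ^ (j * (t - k)) • ket d (t + 1)

/-- `|a⟩_A |b⟩_B |c⟩_C`. -/
noncomputable def tri {d : ℕ} (a b c : EuclideanSpace ℂ (Fin d)) : State (Fin 3) d :=
  productVec ![a, b, c]

/-- The states `f i j` for `(i, j) ∈ ℤ_n × ℤ_n \ {(0, 0)}`. -/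
def family {d : ℕ} (n : ℕ) (f : ℕ → ℕ → State (Fin 3) d) : Set (State (Fin 3) d) :=
  {ψ | ∃ i j : ℕ, i < n ∧ j < n ∧ (i, j) ≠ (0, 0) ∧ ψ = f i j}

/-- `A_1^{(d,d-2k)}`. -/
def A1 (d k : ℕ) : Set (State (Fin 3) d) :=
  family (d - 1 - 2 * k) fun i j => tri (xi d k j) (ket d k) (eta d k i)

/-- `A_2^{(d,d-2k)}`. -/
def A2 (d k : ℕ) : Set (State (Fin 3) d) :=
  family (d - 1 - 2 * k) fun i j => tri (xi d k j) (eta d k i) (ket d (d - 1 - k))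

/-- `A_3^{(d,d-2k)}`. -/
def A3 (d k : ℕ) : Set (State (Fin 3) d) :=
  family (d - 1 - 2 * k) fun i j => tri (ket d (d - 1 - k)) (xi d k j) (eta d k i)

/-- `B_1^{(d,d-2k)}`. -/
def B1 (d k : ℕ) : Set (State (Fin 3) d) :=
  family (d - 1 - 2 * k) fun i j => tri (eta d k i) (ket d (d - 1 - k)) (xi d k j)

/-- `B_2^{(d,d-2k)}`. -/
def B2 (d k : ℕ) : Set (State (Fin 3) d) :=
  family (d - 1 - 2 * k) fun i j => tri (eta d k i) (xi d k j) (ket d k)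

/-- `B_3^{(d,d-2k)}`. -/
def B3 (d k : ℕ) : Set (State (Fin 3) d) :=
  family (d - 1 - 2 * k) fun i j => tri (ket d k) (eta d k i) (xi d k j)

/-- `C^{(d,d-2k)}`, the union of the six blocks. -/
def C (d k : ℕ) : Set (State (Fin 3) d) :=
  A1 d k ∪ A2 d k ∪ A3 d k ∪ B1 d k ∪ B2 d k ∪ B3 d k

/-- `|φ_i⟩ = |(d-2)/2⟩ + (-1)^i |d/2⟩` (for even `d`). -/
noncomputable def phi (d i : ℕ) : EuclideanSpace ℂ (Fin d) :=
  ket d ((d - 2) / 2) + (-1 : ℂ) ^ i • ket d (d / 2)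

/-- `A^{(d,0)}` (for even `d`): the states `|φ_r⟩|φ_s⟩|φ_t⟩` with
`(r, s, t) ∈ ℤ_2 × ℤ_2 × ℤ_2 \ {(0, 0, 0)}`. -/
def A0 (d : ℕ) : Set (State (Fin 3) d) :=
  {ψ | ∃ r s t : ℕ, r < 2 ∧ s < 2 ∧ t < 2 ∧ (r, s, t) ≠ (0, 0, 0) ∧
    ψ = tri (phi d r) (phi d s) (phi d t)}

/-- The stopper state `|S_d⟩`. -/
noncomputable def stopper (d : ℕ) : State (Fin 3) d :=
  tri (∑ i ∈ Finset.range d, ket d i) (∑ j ∈ Finset.range d, ket d j)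
    (∑ k ∈ Finset.range d, ket d k)

/-- The set for odd `d`: `⋃_{k=0}^{(d-3)/2} C^{(d,d-2k)} ∪ {|S_d⟩}`. -/
def oddSet (d : ℕ) : Set (State (Fin 3) d) :=
  (⋃ k ∈ Set.Iic ((d - 3) / 2), C d k) ∪ {stopper d}

/-- The set for even `d`: `⋃_{k=0}^{(d-4)/2} C^{(d,d-2k)} ∪ A^{(d,0)} ∪ {|S_d⟩}`. -/
def evenSet (d : ℕ) : Set (State (Fin 3) d) :=
  (⋃ k ∈ Set.Iic ((d - 4) / 2), C d k) ∪ A0 d ∪ {stopper d}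

end StrongUPB

open scoped ComplexConjugate

/-! ### Fourier vectors and families of disjoint boxes -/

namespace StrongUPB

/-! The computational basis is indexed by the cube `[0, d-1]³`. Its `k`-th shell, without its two
corners on the main diagonal, splits into six disjoint boxes, each one cell thick in one direction,
and cyclic rotation of the parties permutes them. For even `d` there is one more box, the central
cube of side two. The given states are the Fourier basis vectors with nontrivial label of these
boxes, plus the stopper, which is the all-ones vector. The trivial Fourier vector has the same
coefficient in every basis vector of its box, so the difference of two cells of one box is a
combination of the given states (`BoxFamily.basisState_cell_sub`). Everything below uses the states
through such differences and the stopper. The cardinality is one plus the sum of (box size - 1).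

Unextendibility. A product vector `a ⊗ b ⊗ c` orthogonal to all the states is constant on every box
and has coordinate sum zero, so one of the three factor sums is zero. If some factor is nonzero at
an end of its range, the six outer boxes either make a whole factor vanish or make all three sums
nonzero (`ShellConst.someVanishes_of_ne` and its symmetric copies). Otherwise all factors vanish at
both ends, the outer shell can be peeled off, and induction applies (`someVanishes_of_shellConst`).

Nonlocality. Choose a party `p₀` outside `T` and put `N = d - 1`. The Gram matrix of the images of
the basis vectors is `δ_{xx'} e(y,z;y',z')`, where `x` is the coordinate at `p₀` and `e` is `M†M`,
tensored with the identity if a further party is outside `T`. Preserved orthogonality says that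
differences from distinct boxes have orthogonal images, that differences are orthogonal to the image
of the stopper, and that inside one box the Gram form on differences is invariant under cyclic
shifts, being diagonal in the Fourier basis. Only the outermost shell and the stopper are needed.
Projected along `p₀`, four of the outer boxes become the sides of the square `[0, N]²` and two
become the overlapping squares `[1, N] × [0, N-1]` and `[0, N-1] × [1, N]`. Hence `e` does not
couple different sides or a side with the interior, its row and column sums are constant, and it is
shift invariant up to boundary terms (`OrthoKernel.rigid`). Shifting columns of the square onto the
decoupled side `z = 0` then forces `e` to be scalar (`Rigid.eq_scalar`). -/

theorem w_isPrimitiveRoot {n : ℕ} (hn : n ≠ 0) : IsPrimitiveRoot (w n) n :=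
  Complex.isPrimitiveRoot_exp n hn

theorem conj_w_mul_w {n : ℕ} (hn : n ≠ 0) (a : ℕ) : conj (w n ^ a) * w n ^ a = 1 := by
  have h : ‖w n ^ a‖ = 1 := by
    rw [norm_pow, (w_isPrimitiveRoot hn).norm'_eq_one hn, one_pow]
  rw [mul_comm, Complex.mul_conj, Complex.normSq_eq_norm_sq, h]
  simp

theorem w_pow_mod {n : ℕ} (hn : n ≠ 0) (a s : ℕ) : w n ^ (a * (s % n)) = w n ^ (a * s) := by
  conv_rhs => rw [← Nat.mod_add_div s n, mul_add, pow_add,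
    show a * (n * (s / n)) = n * (a * (s / n)) by ring, pow_mul (w n) n,
    (w_isPrimitiveRoot hn).pow_eq_one, one_pow, mul_one]

theorem sum_conj_w_mul_w {n : ℕ} (hn : n ≠ 0) (a b : Fin n) :
    ∑ p : Fin n, conj (w n ^ ((a : ℕ) * p)) * w n ^ ((b : ℕ) * p) = if a = b then (n : ℂ) else 0 := by
  have hw := w_isPrimitiveRoot hn
  split_ifs with h
  · subst h
    simp only [conj_w_mul_w hn]; simp
  · have key : ∀ p : Fin n, conj (w n ^ ((a : ℕ) * p)) * w n ^ ((b : ℕ) * p) =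
        (conj (w n ^ (a : ℕ)) * w n ^ (b : ℕ)) ^ (p : ℕ) := by
      intro p
      rw [pow_mul, pow_mul, map_pow, mul_pow]
    simp_rw [key]
    rw [Fin.sum_univ_eq_sum_range (fun p => (conj (w n ^ (a : ℕ)) * w n ^ (b : ℕ)) ^ p) n]
    set ζ := conj (w n ^ (a : ℕ)) * w n ^ (b : ℕ) with hζ
    have h1 : ζ ≠ 1 := by
      intro h1
      have h2 : w n ^ (b : ℕ) = w n ^ (a : ℕ) := by
        have := congrArg (fun t => w n ^ (a : ℕ) * t) h1
        simp only [hζ, mul_one] at this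
        rw [← mul_assoc, mul_comm (w n ^ (a : ℕ)) (conj _), conj_w_mul_w hn, one_mul] at this
        exact this
      exact h (Fin.ext (hw.pow_inj a.2 b.2 h2.symm))
    have h2 : ζ ^ n = 1 := by
      rw [hζ, mul_pow, ← map_pow, ← pow_mul, ← pow_mul, mul_comm (a : ℕ), mul_comm (b : ℕ), pow_mul,
        pow_mul, hw.pow_eq_one]
      simp
    have h3 := geom_sum_mul ζ n
    rw [h2, sub_self] at h3
    exact (mul_eq_zero.mp h3).resolve_right (sub_ne_zero.mpr h1)

/-- The Fourier vector `∑_{s ≤ m} w_{m+1}^{as} |lo + s⟩`. -/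
noncomputable def fourierKet (d lo m a : ℕ) : EuclideanSpace ℂ (Fin d) :=
  ∑ s : Fin (m + 1), w (m + 1) ^ (a * (s : ℕ)) • ket d (lo + s)

theorem ket_apply (d t : ℕ) (x : Fin d) : ket d t x = if (x : ℕ) = t then 1 else 0 := rfl

theorem fourierKet_apply (d lo m a : ℕ) (x : Fin d) :
    fourierKet d lo m a x =
      ∑ s : Fin (m + 1), w (m + 1) ^ (a * (s : ℕ)) * if (x : ℕ) = lo + s then 1 else 0 := by
  simp [fourierKet, ket_apply]

/-- A family of pairwise disjoint boxes in `κ → Fin d`. -/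
structure BoxFamily (κ ι : Type) (d : ℕ) where
  lo : ι → κ → ℕ
  len : ι → κ → ℕ
  lt : ∀ i q, lo i q + len i q < d
  disj : ∀ i j, i ≠ j → ∃ q, lo i q + len i q < lo j q ∨ lo j q + len j q < lo i q

namespace BoxFamily

variable {κ ι : Type} {d : ℕ} (B : BoxFamily κ ι d)

/-- Positions inside the `i`-th box, and also labels of its Fourier basis. -/
abbrev Pos (i : ι) : Type := ∀ q, Fin (B.len i q + 1)

/-- The cell of the `i`-th box at position `p`. -/
def cell (i : ι) (p : B.Pos i) : κ → Fin d :=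
  fun q => ⟨B.lo i q + p q, by have := B.lt i q; have := (p q).2; omega⟩

theorem cell_injective (i : ι) : Function.Injective (B.cell i) := by
  intro p p' h
  funext q
  have := congrArg Fin.val (congrFun h q)
  simp only [cell] at this
  exact Fin.ext (by omega)

theorem cell_ne {i j : ι} (h : i ≠ j) (p : B.Pos i) (p' : B.Pos j) : B.cell i p ≠ B.cell j p' := by
  intro he
  obtain ⟨q, hq⟩ := B.disj i j h
  have := congrArg Fin.val (congrFun he q)
  simp only [cell] at this
  have := (p q).2
  have := (p' q).2
  omega

variable [Fintype κ]

/-- Characters of the group of positions. -/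
noncomputable def chi (i : ι) (a p : B.Pos i) : ℂ :=
  ∏ q, w (B.len i q + 1) ^ ((a q : ℕ) * (p q : ℕ))

/-- The Fourier basis states of a box. -/
noncomputable def state (i : ι) (a : B.Pos i) : State κ d :=
  productVec fun q => fourierKet d (B.lo i q) (B.len i q) (a q)

theorem chi_symm (i : ι) (a p : B.Pos i) : B.chi i a p = B.chi i p a := by
  simp [chi, mul_comm]

theorem chi_add (i : ι) (a p r : B.Pos i) : B.chi i a (p + r) = B.chi i a p * B.chi i a r := by
  simp only [chi, ← Finset.prod_mul_distrib, Pi.add_apply, Fin.val_add]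
  refine Finset.prod_congr rfl fun q _ => ?_
  rw [w_pow_mod (Nat.succ_ne_zero _), mul_add, pow_add]

theorem chi_zero (i : ι) (p : B.Pos i) : B.chi i 0 p = 1 := by
  simp [chi]

theorem conj_chi_mul_chi (i : ι) (a p : B.Pos i) : conj (B.chi i a p) * B.chi i a p = 1 := by
  simp only [chi, map_prod, ← Finset.prod_mul_distrib]
  exact Finset.prod_eq_one fun q _ => conj_w_mul_w (Nat.succ_ne_zero _) _

variable [DecidableEq κ]

theorem sum_conj_chi_mul_chi (i : ι) (a b : B.Pos i) :
    ∑ p, conj (B.chi i a p) * B.chi i b p =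
      if a = b then (Fintype.card (B.Pos i) : ℂ) else 0 := by
  simp only [chi, map_prod, ← Finset.prod_mul_distrib]
  rw [← Fintype.prod_sum fun q (s : Fin (B.len i q + 1)) =>
    conj (w (B.len i q + 1) ^ ((a q : ℕ) * (s : ℕ))) * w (B.len i q + 1) ^ ((b q : ℕ) * (s : ℕ))]
  simp_rw [sum_conj_w_mul_w (Nat.succ_ne_zero _)]
  split_ifs with h
  · subst h
    simp
  · obtain ⟨q, hq⟩ := Function.ne_iff.mp h
    exact Finset.prod_eq_zero (Finset.mem_univ q) (by simp [hq])

/-- The computational basis states. -/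
noncomputable abbrev basisState (x : κ → Fin d) : State κ d := EuclideanSpace.single x (1 : ℂ)

theorem state_eq_sum (i : ι) (a : B.Pos i) :
    B.state i a = ∑ p, B.chi i a p • basisState (B.cell i p) := by
  ext x
  simp only [state, productVec, fourierKet_apply, Finset.prod_univ_sum, WithLp.ofLp_sum,
    Finset.sum_apply, WithLp.ofLp_smul, Pi.smul_apply, smul_eq_mul]
  rw [Fintype.piFinset_univ]
  refine Finset.sum_congr rfl fun p _ => ?_
  rw [Finset.prod_mul_distrib, chi]
  congr 1
  rw [Finset.prod_ite_zero]
  simp only [basisState, PiLp.single_apply, Finset.prod_const_one]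
  refine if_congr ?_ rfl rfl
  simp [funext_iff, cell, Fin.ext_iff]

theorem card_pos_ne_zero (i : ι) : (Fintype.card (B.Pos i) : ℂ) ≠ 0 :=
  Nat.cast_ne_zero.mpr Fintype.card_ne_zero

theorem basisState_cell (i : ι) (p : B.Pos i) :
    basisState (B.cell i p) =
      (Fintype.card (B.Pos i) : ℂ)⁻¹ • ∑ a, conj (B.chi i a p) • B.state i a := by
  rw [eq_inv_smul_iff₀ (B.card_pos_ne_zero i)]
  simp_rw [state_eq_sum, Finset.smul_sum, smul_smul]
  rw [Finset.sum_comm]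
  simp_rw [← Finset.sum_smul]
  have : ∀ q, ∑ a, conj (B.chi i a p) * B.chi i a q =
      if p = q then (Fintype.card (B.Pos i) : ℂ) else 0 := by
    intro q
    rw [← sum_conj_chi_mul_chi]
    exact Finset.sum_congr rfl fun a _ => by rw [chi_symm, B.chi_symm i a q]
  simp [this]

/-- By Fourier inversion in the box. The term `a = 0` has coefficient `1 - 1`, so only states with
nontrivial label really occur. -/
theorem basisState_cell_sub (i : ι) (p p₀ : B.Pos i) :
    basisState (B.cell i p) - basisState (B.cell i p₀) = (Fintype.card (B.Pos i) : ℂ)⁻¹ •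
      ∑ a, (conj (B.chi i a p) - conj (B.chi i a p₀)) • B.state i a := by
  simp only [basisState_cell, ← smul_sub, ← Finset.sum_sub_distrib, sub_smul]

theorem inner_basisState_left (x : κ → Fin d) (ψ : State κ d) :
    inner ℂ (basisState x) ψ = ψ x := by
  rw [EuclideanSpace.inner_single_left]
  simp

theorem inner_basisState (x y : κ → Fin d) :
    inner ℂ (basisState x) (basisState y) = if x = y then (1 : ℂ) else 0 := by
  rw [inner_basisState_left]
  simp [basisState, PiLp.single_apply]

theorem inner_state_same (i : ι) (a b : B.Pos i) :
    inner ℂ (B.state i a) (B.state i b) =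
      if a = b then (Fintype.card (B.Pos i) : ℂ) else 0 := by
  simp only [state_eq_sum, sum_inner, inner_sum, inner_smul_left, inner_smul_right,
    inner_basisState, (B.cell_injective i).eq_iff]
  rw [← sum_conj_chi_mul_chi]
  simp [mul_comm]

theorem inner_state_ne {i j : ι} (h : i ≠ j) (a : B.Pos i) (b : B.Pos j) :
    inner ℂ (B.state i a) (B.state j b) = 0 := by
  simp only [state_eq_sum, sum_inner, inner_sum, inner_smul_left, inner_smul_right,
    inner_basisState, B.cell_ne h]
  simp

/-- The sum of all computational basis states. -/
noncomputable def allOnes (κ : Type) [Fintype κ] [DecidableEq κ] (d : ℕ) : State κ d :=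
  ∑ x, basisState x

theorem inner_allOnes_basisState (x : κ → Fin d) :
    inner ℂ (allOnes κ d) (basisState x) = (1 : ℂ) := by
  simp only [allOnes, sum_inner, inner_basisState]
  simp

theorem inner_allOnes_state (i : ι) {a : B.Pos i} (ha : a ≠ 0) :
    inner ℂ (allOnes κ d) (B.state i a) = 0 := by
  simp only [state_eq_sum, inner_sum, inner_smul_right, inner_allOnes_basisState, mul_one]
  have := B.sum_conj_chi_mul_chi i 0 a
  rw [if_neg ha.symm] at this
  simpa [chi_zero] using this

/-- The states with nontrivial label of all boxes, together with the all-ones state. -/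
def states : Set (State κ d) :=
  {ψ | ∃ i, ∃ a : B.Pos i, a ≠ 0 ∧ ψ = B.state i a} ∪ {allOnes κ d}

/-- The labelling of the elements of `states`. -/
noncomputable def labelled : Option (Σ i, {a : B.Pos i // a ≠ 0}) → State κ d
  | none => allOnes κ d
  | some ⟨i, a⟩ => B.state i a

theorem range_labelled : Set.range B.labelled = B.states := by
  ext ψ
  constructor
  · rintro ⟨_ | ⟨i, a, ha⟩, rfl⟩
    · exact Or.inr rfl
    · exact Or.inl ⟨i, a, ha, rfl⟩
  · rintro (⟨i, a, ha, rfl⟩ | rfl)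
    · exact ⟨some ⟨i, a, ha⟩, rfl⟩
    · exact ⟨none, rfl⟩

theorem inner_labelled_ne {l l' : Option (Σ i, {a : B.Pos i // a ≠ 0})} (h : l ≠ l') :
    inner ℂ (B.labelled l) (B.labelled l') = 0 := by
  obtain _ | ⟨i, a, ha⟩ := l <;> obtain _ | ⟨j, b, hb⟩ := l'
  · exact absurd rfl h
  · exact B.inner_allOnes_state j hb
  · rw [inner_eq_zero_symm]
    exact B.inner_allOnes_state i ha
  · by_cases hij : i = j
    · subst hij
      have hab : a ≠ b := by
        rintro rfl
        exact h rfl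
      simp [labelled, inner_state_same, hab]
    · exact B.inner_state_ne hij a b

theorem state_ne_zero (i : ι) (a : B.Pos i) : B.state i a ≠ 0 := by
  rw [← inner_self_ne_zero (𝕜 := ℂ), inner_state_same, if_pos rfl]
  exact B.card_pos_ne_zero i

theorem allOnes_ne_zero [NeZero d] : allOnes κ d ≠ 0 := by
  intro h
  have := inner_allOnes_basisState (κ := κ) (d := d) fun _ => 0
  rw [h, inner_zero_left] at this
  exact zero_ne_one this

theorem labelled_ne_zero [NeZero d] (l) : B.labelled l ≠ 0 := by
  obtain _ | ⟨i, a, ha⟩ := l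
  · exact allOnes_ne_zero
  · exact B.state_ne_zero i a

/-- Nonzero, mutually orthogonal vectors are distinct. This gives the cardinality, and it lets
hypotheses about distinct elements of `states` be applied to distinct labels. -/
theorem labelled_injective [NeZero d] : Function.Injective B.labelled := by
  intro l l' h
  by_contra hne
  have := B.inner_labelled_ne hne
  rw [← h] at this
  exact B.labelled_ne_zero l (inner_self_eq_zero.mp this)

theorem states_pairwise : B.states.Pairwise fun ψ φ => inner ℂ ψ φ = 0 := by
  rw [← range_labelled]
  rintro _ ⟨l, rfl⟩ _ ⟨l', rfl⟩ h
  exact B.inner_labelled_ne fun he => h (by rw [he])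

theorem states_finite [Finite ι] : B.states.Finite := by
  rw [← range_labelled]
  exact Set.finite_range _

theorem ncard_states [NeZero d] [Fintype ι] :
    B.states.ncard = ∑ i, (∏ q, (B.len i q + 1) - 1) + 1 := by
  rw [← range_labelled, ← Set.image_univ, Set.ncard_image_of_injective _ B.labelled_injective,
    Set.ncard_univ, Nat.card_eq_fintype_card, Fintype.card_option, Fintype.card_sigma]
  congr 1
  refine Finset.sum_congr rfl fun i _ => ?_
  rw [Fintype.card_subtype_compl]
  simp

theorem productVec_ones : productVec (fun _ : κ => ∑ i ∈ Finset.range d, ket d i) =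
    allOnes κ d := by
  ext x
  have h : ∀ y : Fin d, (∑ i ∈ Finset.range d, ket d i) y = 1 := by
    intro y
    simp [ket_apply]
  simp [productVec, allOnes, h, basisState, Finset.sum_apply]

theorem states_isProductState [NeZero d] {ψ : State κ d} (h : ψ ∈ B.states) :
    IsProductState ψ := by
  rcases h with ⟨i, a, ha, rfl⟩ | rfl
  · exact ⟨B.state_ne_zero i a, _, rfl⟩
  · exact ⟨allOnes_ne_zero, _, productVec_ones.symm⟩

theorem apply_cell_eq {ψ : State κ d} (h : ψ ∈ (Submodule.span ℂ B.states)ᗮ) (i : ι)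
    (p p₀ : B.Pos i) : ψ (B.cell i p) = ψ (B.cell i p₀) := by
  rw [Submodule.mem_orthogonal] at h
  have h1 : inner ℂ (basisState (B.cell i p) - basisState (B.cell i p₀)) ψ = 0 := by
    apply h
    rw [basisState_cell_sub]
    refine Submodule.smul_mem _ _ (Submodule.sum_mem _ fun a _ => ?_)
    by_cases ha : a = 0
    · subst ha
      simp [chi_zero]
    · exact Submodule.smul_mem _ _ (Submodule.subset_span (Or.inl ⟨i, a, ha, rfl⟩))
  rwa [inner_sub_left, sub_eq_zero, inner_basisState_left, inner_basisState_left] at h1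

theorem sum_apply_eq_zero {ψ : State κ d} (h : ψ ∈ (Submodule.span ℂ B.states)ᗮ) :
    ∑ x, ψ x = 0 := by
  rw [Submodule.mem_orthogonal] at h
  have := h (allOnes κ d) (Submodule.subset_span (Or.inr rfl))
  simpa only [allOnes, sum_inner, inner_basisState_left] using this

/-! ### Gram relations forced by preserved orthogonality -/

section Form

variable {V : Type} [NormedAddCommGroup V] [InnerProductSpace ℂ V] (L : State κ d →ₗ[ℂ] V)

theorem inner_map_sub_of_ne (hL : B.states.Pairwise fun ψ φ => inner ℂ (L ψ) (L φ) = 0)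
    [NeZero d] {i j : ι} (hij : i ≠ j) (p p₀ : B.Pos i) (q q₀ : B.Pos j) :
    inner ℂ (L (basisState (B.cell i p) - basisState (B.cell i p₀)))
      (L (basisState (B.cell j q) - basisState (B.cell j q₀))) = 0 := by
  simp only [basisState_cell_sub, map_smul, map_sum, inner_smul_left, inner_smul_right, sum_inner,
    inner_sum]
  simp only [Finset.mul_sum]
  refine Finset.sum_eq_zero fun b _ => Finset.sum_eq_zero fun a _ => ?_
  by_cases ha : a = 0
  · simp [ha, chi_zero]
  by_cases hb : b = 0
  · simp [hb, chi_zero]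
  have hne : B.state i a ≠ B.state j b := by
    intro h
    have := B.labelled_injective (a₁ := some ⟨i, a, ha⟩) (a₂ := some ⟨j, b, hb⟩) h
    simp only [Option.some.injEq, Sigma.mk.injEq] at this
    exact hij this.1
  simp [hL (Or.inl ⟨i, a, ha, rfl⟩) (Or.inl ⟨j, b, hb, rfl⟩) hne]

/-- For the Gram kernel this says that the row sum is the same at all cells of a box. -/
theorem inner_map_sub_allOnes (hL : B.states.Pairwise fun ψ φ => inner ℂ (L ψ) (L φ) = 0)
    [NeZero d] (i : ι) (p p₀ : B.Pos i) :
    inner ℂ (L (basisState (B.cell i p) - basisState (B.cell i p₀))) (L (allOnes κ d)) = 0 := by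
  simp only [basisState_cell_sub, map_smul, map_sum, inner_smul_left, sum_inner]
  refine mul_eq_zero_of_right _ (Finset.sum_eq_zero fun a _ => ?_)
  by_cases ha : a = 0
  · simp [ha, chi_zero]
  have hne : B.state i a ≠ allOnes κ d := by
    intro h
    have := B.labelled_injective (a₁ := some ⟨i, a, ha⟩) (a₂ := none) h
    simp at this
  simp [hL (Or.inl ⟨i, a, ha, rfl⟩) (Or.inr rfl) hne]

/-- On differences only the nontrivial Fourier vectors enter, and their images are mutually
orthogonal. So the form is diagonal, and a shift by `r` multiplies each diagonal term by `|χ_a(r)|²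
= 1`. -/
theorem inner_map_sub_add (hL : B.states.Pairwise fun ψ φ => inner ℂ (L ψ) (L φ) = 0)
    [NeZero d] (i : ι) (r p p₀ q q₀ : B.Pos i) :
    inner ℂ (L (basisState (B.cell i (p + r)) - basisState (B.cell i (p₀ + r))))
      (L (basisState (B.cell i (q + r)) - basisState (B.cell i (q₀ + r)))) =
    inner ℂ (L (basisState (B.cell i p) - basisState (B.cell i p₀)))
      (L (basisState (B.cell i q) - basisState (B.cell i q₀))) := by
  simp only [basisState_cell_sub, map_smul, map_sum, inner_smul_left, inner_smul_right, sum_inner,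
    inner_sum]
  simp only [Finset.mul_sum]
  refine Finset.sum_congr rfl fun b _ => Finset.sum_congr rfl fun a _ => ?_
  by_cases ha : a = 0
  · simp [ha, chi_zero]
  by_cases hb : b = 0
  · simp [hb, chi_zero]
  by_cases hab : a = b
  · subst hab
    have h := B.conj_chi_mul_chi i a r
    simp only [chi_add, map_mul, map_sub, Complex.conj_conj]
    linear_combination ((Fintype.card (B.Pos i) : ℂ)⁻¹ * conj ((Fintype.card (B.Pos i) : ℂ)⁻¹)) *
      (B.chi i a p - B.chi i a p₀) * ((conj (B.chi i a q) - conj (B.chi i a q₀)) *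
        inner ℂ (L (B.state i a)) (L (B.state i a))) * h
  have hne : B.state i a ≠ B.state i b := by
    intro h
    have := B.labelled_injective (a₁ := some ⟨i, a, ha⟩) (a₂ := some ⟨i, b, hb⟩) h
    simp only [Option.some.injEq, Sigma.mk.injEq, heq_eq_eq, Subtype.mk.injEq, true_and] at this
    exact hab this
  simp [hL (Or.inl ⟨i, a, ha, rfl⟩) (Or.inl ⟨i, b, hb, rfl⟩) hne]

end Form

end BoxFamily

end StrongUPB

/-! ### Product vectors that are constant on the boxes -/

namespace StrongUPB

/-- The product `x ↦ a (x 0) b (x 1) c (x 2)` is constant on each of the six outermost boxes of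
the cube `[0, N]³`. -/
structure ShellConst (N : ℕ) (a b c : ℕ → ℂ) : Prop where
  a₁ : ∀ x ∈ Set.Icc 1 N, ∀ x' ∈ Set.Icc 1 N, ∀ z < N, ∀ z' < N,
    a x * b 0 * c z = a x' * b 0 * c z'
  a₂ : ∀ x ∈ Set.Icc 1 N, ∀ x' ∈ Set.Icc 1 N, ∀ y < N, ∀ y' < N,
    a x * b y * c N = a x' * b y' * c N
  a₃ : ∀ y ∈ Set.Icc 1 N, ∀ y' ∈ Set.Icc 1 N, ∀ z < N, ∀ z' < N,
    a N * b y * c z = a N * b y' * c z'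
  b₁ : ∀ x < N, ∀ x' < N, ∀ z ∈ Set.Icc 1 N, ∀ z' ∈ Set.Icc 1 N,
    a x * b N * c z = a x' * b N * c z'
  b₂ : ∀ x < N, ∀ x' < N, ∀ y ∈ Set.Icc 1 N, ∀ y' ∈ Set.Icc 1 N,
    a x * b y * c 0 = a x' * b y' * c 0
  b₃ : ∀ y < N, ∀ y' < N, ∀ z ∈ Set.Icc 1 N, ∀ z' ∈ Set.Icc 1 N,
    a 0 * b y * c z = a 0 * b y' * c z'

namespace ShellConst

variable {N : ℕ} {a b c : ℕ → ℂ}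

theorem rotate (h : ShellConst N a b c) : ShellConst N b c a where
  a₁ x hx x' hx' z hz z' hz' := by linear_combination h.b₂ z hz z' hz' x hx x' hx'
  a₂ x hx x' hx' y hy y' hy' := by linear_combination h.a₃ x hx x' hx' y hy y' hy'
  a₃ y hy y' hy' z hz z' hz' := by linear_combination h.b₁ z hz z' hz' y hy y' hy'
  b₁ x hx x' hx' z hz z' hz' := by linear_combination h.a₂ z hz z' hz' x hx x' hx'
  b₂ x hx x' hx' y hy y' hy' := by linear_combination h.b₃ x hx x' hx' y hy y' hy'
  b₃ y hy y' hy' z hz z' hz' := by linear_combination h.a₁ z hz z' hz' y hy y' hy'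

/-- The point reflection of the cube exchanges the box `aᵢ` with `bᵢ`. -/
theorem reflect (h : ShellConst N a b c) :
    ShellConst N (fun x => a (N - x)) (fun x => b (N - x)) (fun x => c (N - x)) where
  a₁ x hx x' hx' z hz z' hz' := by
    obtain ⟨hx1, hx2⟩ := hx
    obtain ⟨hx1', hx2'⟩ := hx'
    exact h.b₁ _ (by omega) _ (by omega) _ ⟨by omega, by omega⟩ _ ⟨by omega, by omega⟩
  a₂ x hx x' hx' z hz z' hz' := by
    obtain ⟨hx1, hx2⟩ := hx
    obtain ⟨hx1', hx2'⟩ := hx'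
    simpa using h.b₂ (N - x) (by omega) (N - x') (by omega) (N - z) ⟨by omega, by omega⟩ (N - z')
      ⟨by omega, by omega⟩
  a₃ x hx x' hx' z hz z' hz' := by
    obtain ⟨hx1, hx2⟩ := hx
    obtain ⟨hx1', hx2'⟩ := hx'
    simpa using h.b₃ (N - x) (by omega) (N - x') (by omega) (N - z) ⟨by omega, by omega⟩ (N - z')
      ⟨by omega, by omega⟩
  b₁ z hz z' hz' x hx x' hx' := by
    obtain ⟨hx1, hx2⟩ := hx
    obtain ⟨hx1', hx2'⟩ := hx'
    simpa using h.a₁ (N - z) ⟨by omega, by omega⟩ (N - z') ⟨by omega, by omega⟩ (N - x) (by omega)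
      (N - x') (by omega)
  b₂ z hz z' hz' x hx x' hx' := by
    obtain ⟨hx1, hx2⟩ := hx
    obtain ⟨hx1', hx2'⟩ := hx'
    simpa using h.a₂ (N - z) ⟨by omega, by omega⟩ (N - z') ⟨by omega, by omega⟩ (N - x) (by omega)
      (N - x') (by omega)
  b₃ z hz z' hz' x hx x' hx' := by
    obtain ⟨hx1, hx2⟩ := hx
    obtain ⟨hx1', hx2'⟩ := hx'
    simpa using h.a₃ (N - z) ⟨by omega, by omega⟩ (N - z') ⟨by omega, by omega⟩ (N - x) (by omega)
      (N - x') (by omega)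

end ShellConst

theorem sum_eq_of_const_pos {N : ℕ} {f : ℕ → ℂ} {v : ℂ} (h : ∀ x, 1 ≤ x → x ≤ N → f x = v) :
    ∑ x ∈ Finset.range (N + 1), f x = f 0 + N * v := by
  rw [Finset.sum_range_succ', Finset.sum_congr rfl fun x hx =>
    h (x + 1) (by omega) (by simpa using hx)]
  simp [add_comm]

theorem sum_eq_of_const_lt {N : ℕ} {f : ℕ → ℂ} {v : ℂ} (h : ∀ x, x < N → f x = v) :
    ∑ x ∈ Finset.range (N + 1), f x = N * v + f N := by
  rw [Finset.sum_range_succ, Finset.sum_congr rfl fun x hx => h x (by simpa using hx)]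
  simp

/-- If `f x * g z` is constant on a rectangle, then one of the factors vanishes or both are
constant there. -/
theorem const_of_mul_const {s t : Set ℕ} {f g : ℕ → ℂ} {m : ℂ} (hm : m ≠ 0)
    (h : ∀ x ∈ s, ∀ x' ∈ s, ∀ z ∈ t, ∀ z' ∈ t, m * (f x * g z) = m * (f x' * g z')) :
    (∀ x ∈ s, f x = 0) ∨ (∀ z ∈ t, g z = 0) ∨
      ((∃ v ≠ 0, ∀ x ∈ s, f x = v) ∧ ∃ v ≠ 0, ∀ z ∈ t, g z = v) := by
  by_cases h1 : ∀ x ∈ s, f x = 0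
  · exact Or.inl h1
  by_cases h2 : ∀ z ∈ t, g z = 0
  · exact Or.inr (Or.inl h2)
  push Not at h1 h2
  obtain ⟨x, hx, hfx⟩ := h1
  obtain ⟨z, hz, hgz⟩ := h2
  refine Or.inr (Or.inr ⟨⟨f x, hfx, fun x' hx' => ?_⟩, ⟨g z, hgz, fun z' hz' => ?_⟩⟩)
  · exact mul_right_cancel₀ hgz (mul_left_cancel₀ hm (h x' hx' x hx z hz z hz))
  · exact mul_left_cancel₀ hfx (mul_left_cancel₀ hm (h x hx x hx z' hz' z hz))

/-- One of the three functions vanishes on `[0, N]`. -/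
def SomeVanishes (N : ℕ) (a b c : ℕ → ℂ) : Prop :=
  (∀ x ≤ N, a x = 0) ∨ (∀ x ≤ N, b x = 0) ∨ (∀ x ≤ N, c x = 0)

/-- As `b 0 ≠ 0`, the box `a₁` makes `a` on `[1, N]` or `c` on `[0, N-1]` vanish, or both nonzero
constants. The other boxes then fix the remaining end values. Each branch ends with a vanishing
factor or a contradiction, typically because the three sums are explicit and nonzero. -/
theorem ShellConst.someVanishes_of_ne {N : ℕ} (hN : 2 ≤ N) {a b c : ℕ → ℂ}
    (h : ShellConst N a b c) (hb : b 0 ≠ 0)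
    (hs : (∑ x ∈ Finset.range (N + 1), a x) * (∑ x ∈ Finset.range (N + 1), b x) *
      (∑ x ∈ Finset.range (N + 1), c x) = 0) : SomeVanishes N a b c := by
  have hN0 : (N : ℂ) ≠ 0 := Nat.cast_ne_zero.mpr (by omega)
  have one_mem : 1 ∈ Set.Icc 1 N := ⟨le_rfl, by omega⟩
  have N_mem : N ∈ Set.Icc 1 N := ⟨by omega, le_rfl⟩
  have case_a : (∀ x ∈ Set.Icc 1 N, a x = 0) → SomeVanishes N a b c := by
    intro ha
    by_cases ha0 : a 0 = 0
    · left
      intro x hx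
      rcases Nat.eq_zero_or_pos x with rfl | hx0
      · exact ha0
      · exact ha x ⟨hx0, hx⟩
    rw [sum_eq_of_const_pos (f := a) (v := 0) fun x h1 h2 => ha x ⟨h1, h2⟩] at hs
    rcases const_of_mul_const (s := Set.Iio N) (t := Set.Icc 1 N) (f := b) (g := c) ha0
      (fun y hy y' hy' z hz z' hz' => by
        linear_combination h.b₃ y hy y' hy' z hz z' hz') with hb' | hc | ⟨⟨v, hv, hbv⟩, u, hu, hcu⟩
    · exact absurd (hb' 0 (show 0 < N by omega)) hb
    · by_cases hc0 : c 0 = 0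
      · right; right
        intro x hx
        rcases Nat.eq_zero_or_pos x with rfl | hx0
        · exact hc0
        · exact hc x ⟨hx0, hx⟩
      have hb' : ∀ y ∈ Set.Icc 1 N, b y = 0 := by
        intro y hy
        have := h.b₂ 0 (by omega) 1 (by omega) y hy y hy
        rw [ha 1 one_mem] at this
        simpa [ha0, hc0] using this
      rw [sum_eq_of_const_pos (f := b) (v := 0) fun x h1 h2 => hb' x ⟨h1, h2⟩,
        sum_eq_of_const_pos (f := c) (v := 0) fun x h1 h2 => hc x ⟨h1, h2⟩] at hs
      simp [ha0, hb, hc0] at hs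
    · have hb1 : b 1 = v := hbv 1 (show 1 < N by omega)
      have hc0 : c 0 = 0 := by
        have := h.b₂ 0 (by omega) 1 (by omega) 1 one_mem 1 one_mem
        rw [ha 1 one_mem, hb1] at this
        simpa [ha0, hv] using this
      have hbN : b N = 0 := by
        have := h.b₁ 0 (by omega) 1 (by omega) 1 one_mem 1 one_mem
        rw [ha 1 one_mem, hcu 1 one_mem] at this
        simpa [ha0, hu] using this
      rw [sum_eq_of_const_lt (f := b) hbv,
        sum_eq_of_const_pos (f := c) fun x h1 h2 => hcu x ⟨h1, h2⟩, hc0, hbN] at hs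
      simp [ha0, hv, hu, hN0] at hs
  rcases const_of_mul_const (s := Set.Icc 1 N) (t := Set.Iio N) (f := a) (g := c) hb
    (fun x hx x' hx' z hz z' hz' => by
      linear_combination h.a₁ x hx x' hx' z hz z' hz') with ha | hc | ⟨⟨v, hv, hav⟩, u, hu, hcu⟩
  · exact case_a ha
  · have hc1 : c 1 = 0 := hc 1 (show 1 < N by omega)
    by_cases hcN : c N = 0
    · right; right
      intro x hx
      rcases hx.lt_or_eq with hx | rfl
      · exact hc x hx
      · exact hcN
    rcases const_of_mul_const (s := Set.Icc 1 N) (t := Set.Iio N) (f := a) (g := b) hcN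
      (fun x hx x' hx' z hz z' hz' => by
        linear_combination h.a₂ x hx x' hx' z hz z' hz') with ha | hb' | ⟨⟨v, hv, hav⟩, u, hu, hbu⟩
    · exact case_a ha
    · exact absurd (hb' 0 (show 0 < N by omega)) hb
    · have hbN : b N = 0 := by
        have := h.b₁ 1 (by omega) 1 (by omega) 1 one_mem N N_mem
        rw [hav 1 one_mem, hc1] at this
        simpa [hcN, hv] using this.symm
      have ha0 : a 0 = 0 := by
        have := h.b₃ 1 (by omega) 1 (by omega) 1 one_mem N N_mem
        rw [hc1, hbu 1 (show 1 < N by omega)] at this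
        simpa [hcN, hu] using this.symm
      rw [sum_eq_of_const_lt (f := b) hbu, sum_eq_of_const_lt (f := c) hc,
        sum_eq_of_const_pos (f := a) fun x h1 h2 => hav x ⟨h1, h2⟩, ha0, hbN] at hs
      simp [hcN, hv, hu, hN0] at hs
  · have hc1 : c 1 = u := hcu 1 (show 1 < N by omega)
    have hc0 : c 0 = u := hcu 0 (show 0 < N by omega)
    have haN : a N ≠ 0 := by rwa [hav N N_mem]
    rcases const_of_mul_const (s := Set.Icc 1 N) (t := Set.Iio N) (f := b) (g := c) haN
      (fun x hx x' hx' z hz z' hz' => by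
        linear_combination h.a₃ x hx x' hx' z hz z' hz') with
      hb' | hc' | ⟨⟨t, ht, hbt⟩, -⟩
    · have ha0 : a 0 = 0 := by
        have := h.b₃ 0 (by omega) 1 (by omega) 1 one_mem 1 one_mem
        rw [hb' 1 one_mem, hc1] at this
        simpa [hb, hu] using this
      have hcN : c N = 0 := by
        have := h.a₂ 1 one_mem 1 one_mem 0 (by omega) 1 (by omega)
        rw [hb' 1 one_mem, hav 1 one_mem] at this
        simpa [hb, hv] using this
      rw [sum_eq_of_const_pos (f := a) fun x h1 h2 => hav x ⟨h1, h2⟩,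
        sum_eq_of_const_pos (f := b) fun x h1 h2 => hb' x ⟨h1, h2⟩,
        sum_eq_of_const_lt (f := c) hcu, ha0, hcN] at hs
      simp [hb, hv, hu, hN0] at hs
    · exact absurd (hc' 1 (show 1 < N by omega)) (by rwa [hc1])
    -- Here all three factors are constant on the whole of `[0, N]`, so the total sum is `(N + 1)³ v
    -- t u`.
    · have ha0 : a 0 = v := by
        have := h.b₂ 0 (by omega) 1 (by omega) 1 one_mem 1 one_mem
        rw [hbt 1 one_mem, hc0, hav 1 one_mem] at this
        exact mul_right_cancel₀ ht (mul_right_cancel₀ hu this)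
      have hb0 : b 0 = t := by
        have := h.b₃ 0 (by omega) 1 (by omega) 1 one_mem 1 one_mem
        rw [hbt 1 one_mem, hc1, ha0] at this
        exact mul_left_cancel₀ hv (mul_right_cancel₀ hu this)
      have hcN : c N = u := by
        have := h.b₃ 1 (by omega) 1 (by omega) N N_mem 1 one_mem
        rw [hbt 1 one_mem, hc1, ha0] at this
        exact mul_left_cancel₀ (mul_ne_zero hv ht) this
      rw [sum_eq_of_const_pos (f := a) fun x h1 h2 => hav x ⟨h1, h2⟩,
        sum_eq_of_const_pos (f := b) fun x h1 h2 => hbt x ⟨h1, h2⟩,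
        sum_eq_of_const_lt (f := c) hcu, ha0, hb0, hcN] at hs
      have hN1 : (N : ℂ) + 1 ≠ 0 := Nat.cast_add_one_ne_zero N
      have : (N + 1 : ℂ) ^ 3 * (v * t * u) = 0 := by linear_combination hs
      simp [hN1, hv, ht, hu] at this

theorem SomeVanishes.of_rotate {N : ℕ} {a b c : ℕ → ℂ} (h : SomeVanishes N b c a) :
    SomeVanishes N a b c := by
  rcases h with h | h | h
  · exact Or.inr (Or.inl h)
  · exact Or.inr (Or.inr h)
  · exact Or.inl h

theorem SomeVanishes.of_reflect {N : ℕ} {a b c : ℕ → ℂ}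
    (h : SomeVanishes N (fun x => a (N - x)) (fun x => b (N - x)) (fun x => c (N - x))) :
    SomeVanishes N a b c := by
  have key : ∀ f : ℕ → ℂ, (∀ x ≤ N, f (N - x) = 0) → ∀ x ≤ N, f x = 0 := by
    intro f hf x hx
    simpa [Nat.sub_sub_self hx] using hf (N - x) (by omega)
  exact h.imp (key a) (Or.imp (key b) (key c))

/-- Rotation and reflection carry any of the six end values to `b 0`, so
`ShellConst.someVanishes_of_ne` covers them all. -/
theorem ShellConst.someVanishes_or {N : ℕ} (hN : 2 ≤ N) {a b c : ℕ → ℂ}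
    (h : ShellConst N a b c)
    (hs : (∑ x ∈ Finset.range (N + 1), a x) * (∑ x ∈ Finset.range (N + 1), b x) *
      (∑ x ∈ Finset.range (N + 1), c x) = 0) :
    SomeVanishes N a b c ∨ (a 0 = 0 ∧ b 0 = 0 ∧ c 0 = 0 ∧ a N = 0 ∧ b N = 0 ∧ c N = 0) := by
  by_contra hcon
  obtain ⟨hv, hcon⟩ := not_or.mp hcon
  have zero : ∀ {a b c : ℕ → ℂ}, ShellConst N a b c → ¬ SomeVanishes N a b c →
      (∑ x ∈ Finset.range (N + 1), a x) * (∑ x ∈ Finset.range (N + 1), b x) *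
      (∑ x ∈ Finset.range (N + 1), c x) = 0 → a 0 = 0 ∧ b 0 = 0 ∧ c 0 = 0 := by
    intro a b c h hv hs
    refine ⟨?_, ?_, ?_⟩ <;> by_contra h0
    · exact hv (SomeVanishes.of_rotate (SomeVanishes.of_rotate
        (h.rotate.rotate.someVanishes_of_ne hN h0 (by linear_combination hs))))
    · exact hv (h.someVanishes_of_ne hN h0 hs)
    · exact hv (SomeVanishes.of_rotate
        (h.rotate.someVanishes_of_ne hN h0 (by linear_combination hs)))
  obtain ⟨h1, h2, h3⟩ := zero h hv hs
  have refl_sum : ∀ f : ℕ → ℂ, ∑ x ∈ Finset.range (N + 1), f (N - x) =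
      ∑ x ∈ Finset.range (N + 1), f x := by
    intro f
    rw [← Finset.sum_range_reflect]
    exact Finset.sum_congr rfl fun x hx => by
      rw [Finset.mem_range] at hx
      congr 1
      omega
  obtain ⟨h4, h5, h6⟩ := zero h.reflect (fun h => hv h.of_reflect) (by simpa only [refl_sum] using hs)
  exact hcon ⟨h1, h2, h3, by simpa using h4, by simpa using h5, by simpa using h6⟩

/-- Induction in steps of two. When all end values are zero, removing them changes no sum and leaves
the same problem on the inner cube. The base cases are a single cell (`N = 0`) and the central box
(`N = 1`). -/
theorem someVanishes_of_shellConst (N : ℕ) : ∀ (a b c : ℕ → ℂ),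
    (∀ k, 2 * k + 2 ≤ N →
      ShellConst (N - 2 * k) (fun x => a (k + x)) (fun x => b (k + x)) (fun x => c (k + x))) →
    (∀ k, N = 2 * k + 1 → ∀ x ≤ 1, ∀ y ≤ 1, ∀ z ≤ 1,
      a (k + x) * b (k + y) * c (k + z) = a k * b k * c k) →
    (∑ x ∈ Finset.range (N + 1), a x) * (∑ x ∈ Finset.range (N + 1), b x) *
      (∑ x ∈ Finset.range (N + 1), c x) = 0 → SomeVanishes N a b c := by
  induction N using Nat.strong_induction_on with
  | _ N ih =>
    intro a b c hsh hce hs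
    rcases lt_or_ge N 2 with hN | hN
    · interval_cases N
      · simp only [zero_add, Finset.range_one, Finset.sum_singleton, mul_eq_zero] at hs
        simp only [SomeVanishes, Nat.le_zero, forall_eq]
        tauto
      · have h := hce 0 rfl
        simp only [zero_add] at h
        simp only [Finset.sum_range_succ, Finset.range_zero, Finset.sum_empty, zero_add] at hs
        have h0 : a 0 * b 0 * c 0 = 0 := by
          -- The product is constant on the eight cells of the central box, so eight times its value
          -- is the total sum.
          have h8 : 8 * (a 0 * b 0 * c 0) = 0 := by
            linear_combination hs - h 0 (by simp) 0 (by simp) 1 le_rfl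
              - h 0 (by simp) 1 le_rfl 0 (by simp) - h 0 (by simp) 1 le_rfl 1 le_rfl
              - h 1 le_rfl 0 (by simp) 0 (by simp) - h 1 le_rfl 0 (by simp) 1 le_rfl
              - h 1 le_rfl 1 le_rfl 0 (by simp) - h 1 le_rfl 1 le_rfl 1 le_rfl
          simpa using h8
        by_contra hv
        simp only [SomeVanishes, not_or] at hv
        push Not at hv
        obtain ⟨⟨x, hx, hax⟩, ⟨y, hy, hby⟩, z, hz, hcz⟩ := hv
        have := h x hx y hy z hz
        rw [h0] at this
        simp [hax, hby, hcz] at this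
    · have h0 := hsh 0 (by omega)
      simp only [Nat.mul_zero, Nat.sub_zero, zero_add] at h0
      rcases h0.someVanishes_or hN hs with h | ⟨ha0, hb0, hc0, haN, hbN, hcN⟩
      · exact h
      obtain ⟨M, rfl⟩ : ∃ M, N = M + 2 := ⟨N - 2, by omega⟩
      have sum_eq : ∀ f : ℕ → ℂ, f 0 = 0 → f (M + 2) = 0 →
          ∑ x ∈ Finset.range (M + 2 + 1), f x = ∑ x ∈ Finset.range (M + 1), f (x + 1) := by
        intro f h1 h2
        rw [Finset.sum_range_succ, h2, Finset.sum_range_succ', h1, add_zero, add_zero]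
      rw [sum_eq a ha0 haN, sum_eq b hb0 hbN, sum_eq c hc0 hcN] at hs
      have key := ih M (by omega) (fun x => a (x + 1)) (fun x => b (x + 1)) (fun x => c (x + 1))
        (fun k hk => by
          have := hsh (k + 1) (by omega)
          simpa only [show M + 2 - 2 * (k + 1) = M - 2 * k by omega,
            show ∀ x, k + 1 + x = k + x + 1 by intro x; omega] using this)
        (fun k hk x hx y hy z hz => by
          have := hce (k + 1) (by omega) x hx y hy z hz
          simpa only [show ∀ x, k + 1 + x = k + x + 1 by intro x; omega] using this) hs
      have ext : ∀ f : ℕ → ℂ, f 0 = 0 → f (M + 2) = 0 → (∀ x ≤ M, f (x + 1) = 0) →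
          ∀ x ≤ M + 2, f x = 0 := by
        intro f h1 h2 h3 x hx
        rcases Nat.eq_zero_or_pos x with rfl | hx0
        · exact h1
        rcases hx.lt_or_eq with hx | rfl
        · obtain ⟨t, rfl⟩ : ∃ t, x = t + 1 := ⟨x - 1, by omega⟩
          exact h3 t (by omega)
        · exact h2
      exact key.imp (ext a ha0 haN) (Or.imp (ext b hb0 hbN) (ext c hc0 hcN))

end StrongUPB

/-! ### Rigidity of kernels on a square -/

namespace StrongUPB

/-- The side of the boundary of the square `[0, N]²`, with each corner attached to one of its two
sides, to which a point belongs (`0` for interior points). -/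
def side (N y z : ℕ) : ℕ :=
  if y = 0 ∧ z < N then 1 else if z = N ∧ y < N then 2 else if y = N ∧ 0 < z then 3
  else if z = 0 ∧ 0 < y then 4 else 0

/-- The side opposite to a given one. -/
def oppositeSide (i : ℕ) : ℕ :=
  if i = 1 then 3 else if i = 2 then 4 else if i = 3 then 1 else if i = 4 then 2 else 0

theorem side_reflect {N y z : ℕ} (hN : 2 ≤ N) (hy : y ≤ N) (hz : z ≤ N) :
    side N (N - y) (N - z) = oppositeSide (side N y z) := by
  unfold side
  split_ifs <;> first | rfl | omega

theorem oppositeSide_oppositeSide {N y z : ℕ} :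
    oppositeSide (oppositeSide (side N y z)) = side N y z := by
  unfold side
  split_ifs <;> rfl

/-- The alternating sum of a kernel over a pair of pairs of points. -/
def altSum (e : ℕ → ℕ → ℕ → ℕ → ℂ) (y z y₀ z₀ a s a₀ s₀ : ℕ) : ℂ :=
  e y z a s - e y₀ z₀ a s - e y z a₀ s₀ + e y₀ z₀ a₀ s₀

/-- Kernels on `[0, N]²` that do not couple different sides of the boundary, have constant row and
column sums, and have alternating sums on `[1, N] × [0, N - 1]` and `[0, N - 1] × [1, N]` which are
invariant under cyclic shifts. -/
structure Rigid (N : ℕ) (e : ℕ → ℕ → ℕ → ℕ → ℂ) (c : ℂ) : Prop where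
  dec : ∀ y z y' z', y ≤ N → z ≤ N → y' ≤ N → z' ≤ N → side N y z ≠ side N y' z' → e y z y' z' = 0
  row : ∀ y z, y ≤ N → z ≤ N →
    ∑ y' ∈ Finset.range (N + 1), ∑ z' ∈ Finset.range (N + 1), e y z y' z' = c
  col : ∀ y z, y ≤ N → z ≤ N →
    ∑ y' ∈ Finset.range (N + 1), ∑ z' ∈ Finset.range (N + 1), e y' z' y z = c
  shift : ∀ ρ ρ' s t s₀ t₀ a b a₀ b₀, s < N → t < N → s₀ < N → t₀ < N → a < N → b < N →
    a₀ < N → b₀ < N →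
    altSum e (1 + (s + ρ) % N) ((t + ρ') % N) (1 + (s₀ + ρ) % N) ((t₀ + ρ') % N)
      (1 + (a + ρ) % N) ((b + ρ') % N) (1 + (a₀ + ρ) % N) ((b₀ + ρ') % N) =
    altSum e (1 + s) t (1 + s₀) t₀ (1 + a) b (1 + a₀) b₀
  shift' : ∀ ρ ρ' s t s₀ t₀ a b a₀ b₀, s < N → t < N → s₀ < N → t₀ < N → a < N → b < N →
    a₀ < N → b₀ < N →
    altSum e ((s + ρ) % N) (1 + (t + ρ') % N) ((s₀ + ρ) % N) (1 + (t₀ + ρ') % N)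
      ((a + ρ) % N) (1 + (b + ρ') % N) ((a₀ + ρ) % N) (1 + (b₀ + ρ') % N) =
    altSum e s (1 + t) s₀ (1 + t₀) a (1 + b) a₀ (1 + b₀)

/-- The reflection `s ↦ N - 1 - s` of `ℤ/N` turns the shift by `ρ` into the shift by `-ρ`, written
`N - ρ % N` to stay in `ℕ`. -/
theorem reflect_shift {N s : ℕ} (hs : s < N) (ρ : ℕ) :
    N - 1 - (s + ρ) % N = (N - 1 - s + (N - ρ % N)) % N := by
  have h : (s + ρ) % N = (s + ρ % N) % N := by simp
  rw [h]
  have h1 : ρ % N < N := Nat.mod_lt _ (by omega)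
  generalize ρ % N = r at *
  rcases lt_or_ge (s + r) N with h2 | h2
  · rw [Nat.mod_eq_of_lt h2, Nat.mod_eq_sub_mod (by omega), Nat.mod_eq_of_lt (by omega)]
    omega
  · rw [Nat.mod_eq_sub_mod h2, Nat.mod_eq_of_lt (a := s + r - N) (by omega),
      Nat.mod_eq_of_lt (by omega)]
    omega

namespace Rigid

variable {N : ℕ} {e : ℕ → ℕ → ℕ → ℕ → ℂ} {c : ℂ}

/-- The point reflection permutes the sides and exchanges the two squares, hence `shift` and
`shift'`. It halves the work that follows. -/
theorem reflect (hN : 2 ≤ N) (h : Rigid N e c) :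
    Rigid N (fun y z y' z' => e (N - y) (N - z) (N - y') (N - z')) c where
  dec y z y' z' hy hz hy' hz' hne := by
    refine h.dec _ _ _ _ (by omega) (by omega) (by omega) (by omega) fun heq => hne ?_
    rw [side_reflect hN hy hz, side_reflect hN hy' hz'] at heq
    rw [← oppositeSide_oppositeSide, heq, oppositeSide_oppositeSide]
  row y z hy hz := by
    rw [← h.row (N - y) (N - z) (by omega) (by omega), ← Finset.sum_range_reflect]
    refine Finset.sum_congr rfl fun y' _ => ?_
    rw [← Finset.sum_range_reflect]
    exact Finset.sum_congr rfl fun z' hz' => by simp_all; congr 1 <;> omega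
  col y z hy hz := by
    rw [← h.col (N - y) (N - z) (by omega) (by omega), ← Finset.sum_range_reflect]
    refine Finset.sum_congr rfl fun y' _ => ?_
    rw [← Finset.sum_range_reflect]
    exact Finset.sum_congr rfl fun z' hz' => by simp_all; congr 1 <;> omega
  shift ρ ρ' s t s₀ t₀ a b a₀ b₀ hs ht hs₀ ht₀ ha hb ha₀ hb₀ := by
    have e1 : ∀ {s ρ}, s < N → N - (1 + (s + ρ) % N) = (N - 1 - s + (N - ρ % N)) % N := by
      intro s ρ hs
      rw [← reflect_shift hs]
      omega
    have e2 : ∀ {s ρ}, s < N → N - (s + ρ) % N = 1 + (N - 1 - s + (N - ρ % N)) % N := by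
      intro s ρ hs
      rw [← reflect_shift hs]
      have := Nat.mod_lt (s + ρ) (show 0 < N by omega)
      omega
    have e3 : ∀ {s}, s < N → N - (1 + s) = N - 1 - s := by intro s hs; omega
    have e4 : ∀ {s}, s < N → N - s = 1 + (N - 1 - s) := by intro s hs; omega
    simp only [altSum]
    rw [e1 hs, e2 ht, e1 hs₀, e2 ht₀, e1 ha, e2 hb, e1 ha₀, e2 hb₀, e3 hs, e3 hs₀, e3 ha, e3 ha₀,
      e4 ht, e4 ht₀, e4 hb, e4 hb₀]
    exact h.shift' (N - ρ % N) (N - ρ' % N) (N - 1 - s) (N - 1 - t) (N - 1 - s₀) (N - 1 - t₀)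
      (N - 1 - a) (N - 1 - b) (N - 1 - a₀) (N - 1 - b₀) (by omega) (by omega) (by omega) (by omega)
      (by omega) (by omega) (by omega) (by omega)
  shift' ρ ρ' s t s₀ t₀ a b a₀ b₀ hs ht hs₀ ht₀ ha hb ha₀ hb₀ := by
    have e1 : ∀ {s ρ}, s < N → N - (1 + (s + ρ) % N) = (N - 1 - s + (N - ρ % N)) % N := by
      intro s ρ hs
      rw [← reflect_shift hs]
      omega
    have e2 : ∀ {s ρ}, s < N → N - (s + ρ) % N = 1 + (N - 1 - s + (N - ρ % N)) % N := by
      intro s ρ hs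
      rw [← reflect_shift hs]
      have := Nat.mod_lt (s + ρ) (show 0 < N by omega)
      omega
    have e3 : ∀ {s}, s < N → N - (1 + s) = N - 1 - s := by intro s hs; omega
    have e4 : ∀ {s}, s < N → N - s = 1 + (N - 1 - s) := by intro s hs; omega
    simp only [altSum]
    rw [e2 hs, e1 ht, e2 hs₀, e1 ht₀, e2 ha, e1 hb, e2 ha₀, e1 hb₀, e4 hs, e4 hs₀, e4 ha, e4 ha₀,
      e3 ht, e3 ht₀, e3 hb, e3 hb₀]
    exact h.shift (N - ρ % N) (N - ρ' % N) (N - 1 - s) (N - 1 - t) (N - 1 - s₀) (N - 1 - t₀)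
      (N - 1 - a) (N - 1 - b) (N - 1 - a₀) (N - 1 - b₀) (by omega) (by omega) (by omega) (by omega)
      (by omega) (by omega) (by omega) (by omega)

theorem side_column {N s : ℕ} (hN : 2 ≤ N) : side N (1 + s) 0 = 4 := by
  unfold side
  split_ifs <;> omega

theorem side_ne_column {N y z : ℕ} (hN : 2 ≤ N) (hy : y ≤ N) (hz : z ≤ N) (h : y = 0 ∨ 0 < z) :
    side N y z ≠ 4 := by
  unfold side
  split_ifs <;> omega

theorem side_interior {N s t : ℕ} (hs : 1 + s < N) (ht : t < N) (h : 0 < t) :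
    side N (1 + s) t = 0 := by
  unfold side
  split_ifs <;> omega

theorem side_last {N t : ℕ} (hN : 2 ≤ N) (h : 0 < t) : side N N t = 3 := by
  unfold side
  split_ifs <;> omega

theorem side_boundary {N y z : ℕ} (hN : 2 ≤ N) (hy : y ≤ N) (hz : z ≤ N) (h : y = 0 ∨ z = N) :
    side N y z ≠ 0 ∧ side N y z ≠ 4 := by
  unfold side
  split_ifs <;> omega

/-- Column `0` of the square `[1, N] × [0, N-1]` is exactly side `4`, so it is decoupled from every
other column. All the shift arguments below exploit this. -/
theorem dec_left (hN : 2 ≤ N) (h : Rigid N e c) {s y z : ℕ} (hs : s < N) (hy : y ≤ N)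
    (hz : z ≤ N) (hyz : y = 0 ∨ 0 < z) : e (1 + s) 0 y z = 0 :=
  h.dec _ _ _ _ (by omega) (by omega) hy hz
    (by rw [side_column hN]; exact (side_ne_column hN hy hz hyz).symm)

theorem dec_right (hN : 2 ≤ N) (h : Rigid N e c) {s y z : ℕ} (hs : s < N) (hy : y ≤ N)
    (hz : z ≤ N) (hyz : y = 0 ∨ 0 < z) : e y z (1 + s) 0 = 0 :=
  h.dec _ _ _ _ hy hz (by omega) (by omega)
    (by rw [side_column hN]; exact side_ne_column hN hy hz hyz)

/-- Shift by `τ` in the column direction, so that column `τ` comes from column `0`. Before the shift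
every term pairs column `0` with another column and vanishes. After it only the two terms of the
claim survive. -/
theorem off_column (hN : 2 ≤ N) (h : Rigid N e c) {s t a b τ : ℕ} (hs : s < N) (ht : t < N)
    (ha : a < N) (hb : b < N) (hτ : τ < N) (hτ0 : 0 < τ) (htτ : t ≠ τ) :
    e (1 + s) t (1 + a) τ = e (1 + s) t (1 + b) τ := by
  have hmod : (t + N - τ) % N < N := Nat.mod_lt _ (by omega)
  have hpos : 0 < (t + N - τ) % N := by
    rcases lt_or_ge t τ with h1 | h1
    · rw [Nat.mod_eq_of_lt (by omega)]
      omega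
    · rw [show t + N - τ = t - τ + N by omega, Nat.add_mod_right, Nat.mod_eq_of_lt (by omega)]
      omega
  have hback : ((t + N - τ) % N + τ) % N = t := by
    rw [Nat.mod_add_mod, show t + N - τ + τ = t + N by omega, Nat.add_mod_right,
      Nat.mod_eq_of_lt ht]
  -- The reference point `(N, N - τ)` is chosen to land at `(N, 0)` in column `0`, where it
  -- decouples from column `τ`.
  have key := h.shift 0 τ s ((t + N - τ) % N) (N - 1) (N - τ) a 0 b 0 hs hmod (by omega)
    (by omega) ha (by omega) hb (by omega)
  rw [hback, show N - τ + τ = N by omega, Nat.mod_self] at key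
  simp only [add_zero, zero_add, Nat.mod_eq_of_lt hs, Nat.mod_eq_of_lt ha, Nat.mod_eq_of_lt hb,
    Nat.mod_eq_of_lt hτ, Nat.mod_eq_of_lt (show N - 1 < N by omega), altSum] at key
  rw [h.dec_left hN (by omega) (by omega) (by omega) (Or.inr hτ0),
    h.dec_left hN (by omega) (by omega) (by omega) (Or.inr hτ0),
    h.dec_right hN (by omega) (by omega) (by omega) (Or.inr hpos),
    h.dec_right hN (by omega) (by omega) (by omega) (Or.inr hpos),
    h.dec_right hN (by omega) (by omega) (by omega) (Or.inr (by omega)),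
    h.dec_right hN (by omega) (by omega) (by omega) (Or.inr (by omega))] at key
  linear_combination key

/-- The shift of `off_column` with `t = τ`: now two terms inside column `0` survive before the shift
as well. -/
theorem same_column (hN : 2 ≤ N) (h : Rigid N e c) {s a b τ : ℕ} (hs : s < N)
    (ha : a < N) (hb : b < N) (hτ : τ < N) (hτ0 : 0 < τ) :
    e (1 + s) τ (1 + a) τ - e (1 + s) τ (1 + b) τ =
      e (1 + s) 0 (1 + a) 0 - e (1 + s) 0 (1 + b) 0 := by
  have key := h.shift 0 τ s 0 (N - 1) (N - τ) a 0 b 0 hs (by omega) (by omega)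
    (by omega) ha (by omega) hb (by omega)
  rw [show N - τ + τ = N by omega, Nat.mod_self] at key
  simp only [add_zero, zero_add, Nat.mod_eq_of_lt hs, Nat.mod_eq_of_lt ha, Nat.mod_eq_of_lt hb,
    Nat.mod_eq_of_lt hτ, Nat.mod_eq_of_lt (show N - 1 < N by omega), altSum] at key
  rw [h.dec_left hN (by omega) (by omega) (by omega) (Or.inr hτ0),
    h.dec_left hN (by omega) (by omega) (by omega) (Or.inr hτ0),
    h.dec_right hN (s := a) (y := 1 + (N - 1)) (z := N - τ) ha (by omega) (by omega)
      (Or.inr (by omega)),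
    h.dec_right hN (s := b) (y := 1 + (N - 1)) (z := N - τ) hb (by omega) (by omega)
      (Or.inr (by omega))] at key
  linear_combination key

theorem interior_last (hN : 2 ≤ N) (h : Rigid N e c) {s t τ : ℕ} (hs : 1 + s < N) (ht : t < N)
    (ht0 : 0 < t) (hτ : τ ≤ N) (hτ0 : 0 < τ) : e (1 + s) t N τ = 0 :=
  h.dec _ _ _ _ (by omega) (by omega) (by omega) (by omega) (by
    rw [side_interior hs ht ht0, side_last hN hτ0]
    decide)

theorem last_interior (hN : 2 ≤ N) (h : Rigid N e c) {s t τ : ℕ} (hs : 1 + s < N) (ht : t < N)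
    (ht0 : 0 < t) (hτ : τ ≤ N) (hτ0 : 0 < τ) : e N τ (1 + s) t = 0 :=
  h.dec _ _ _ _ (by omega) (by omega) (by omega) (by omega) (by
    rw [side_interior hs ht ht0, side_last hN hτ0]
    decide)

/-- By `off_column` the target row may be moved freely. Moving it to row `N` pairs an interior point
with side `3`; if the source is already in row `N`, moving the target to row `1` does the same. -/
theorem off_column_eq_zero (hN : 2 ≤ N) (h : Rigid N e c) {s t a τ : ℕ} (hs : s < N) (ht : t < N)
    (ha : a < N) (hτ : τ < N) (htτ : t ≠ τ) : e (1 + s) t (1 + a) τ = 0 := by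
  rcases Nat.eq_zero_or_pos t with rfl | ht0
  · exact h.dec_left hN hs (by omega) (by omega) (Or.inr (by omega))
  rcases Nat.eq_zero_or_pos τ with rfl | hτ0
  · exact h.dec_right hN ha (by omega) (by omega) (Or.inr (by omega))
  rcases lt_or_ge (1 + s) N with h1 | h1
  · rw [h.off_column hN hs ht ha (b := N - 1) (by omega) hτ hτ0 htτ,
      show 1 + (N - 1) = N by omega]
    exact h.interior_last hN h1 ht ht0 hτ.le hτ0
  · rw [h.off_column hN hs ht ha (b := 0) (by omega) hτ hτ0 htτ, show 1 + s = N by omega]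
    exact h.last_interior hN (by omega) hτ hτ0 ht.le ht0

theorem sum_column (hN : 2 ≤ N) (h : Rigid N e c) {s τ : ℕ} (hs : s < N) (hτ : τ < N)
    (hi : τ = 0 ∨ 1 + s < N) : ∑ a ∈ Finset.range N, e (1 + s) τ (1 + a) τ = c := by
  have hside : side N (1 + s) τ = 0 ∨ side N (1 + s) τ = 4 := by
    rcases Nat.eq_zero_or_pos τ with rfl | hτ0
    · exact Or.inr (side_column hN)
    · exact Or.inl (side_interior (hi.resolve_left (by omega)) hτ hτ0)
  have hb : ∀ y z, y ≤ N → z ≤ N → y = 0 ∨ z = N → e (1 + s) τ y z = 0 := by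
    intro y z hy hz hyz
    have := side_boundary hN hy hz hyz
    exact h.dec _ _ _ _ (by omega) (by omega) hy hz (by omega)
  rw [← h.row (1 + s) τ (by omega) (by omega), Finset.sum_range_succ',
    Finset.sum_eq_zero (s := Finset.range (N + 1)) fun z hz =>
      hb 0 z (by omega) (by simpa [Nat.lt_succ_iff] using hz) (Or.inl rfl), add_zero]
  refine Finset.sum_congr rfl fun a ha => ?_
  rw [Finset.mem_range] at ha
  rw [Finset.sum_range_succ, hb _ N (by omega) le_rfl (Or.inr rfl), add_zero,
    Finset.sum_eq_single τ, add_comm a 1]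
  · intro z hz hne
    rw [Finset.mem_range] at hz
    rw [add_comm a 1]
    exact h.off_column_eq_zero hN hs hτ ha hz hne.symm
  · simp [hτ]

/-- The sums along columns `0` and `1` both equal `c`. By `same_column`, entries in column `1` are
those in column `0` minus `e (1 + s) 0 N 0`, so `N` times that number is zero. -/
theorem column_last (hN : 2 ≤ N) (h : Rigid N e c) {s : ℕ} (hs : 1 + s < N) :
    e (1 + s) 0 N 0 = 0 := by
  have h0 := h.sum_column hN (s := s) (τ := 0) (by omega) (by omega) (Or.inl rfl)
  have h1 := h.sum_column hN (s := s) (τ := 1) (by omega) (by omega) (Or.inr hs)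
  have hN0 : (N : ℂ) ≠ 0 := Nat.cast_ne_zero.mpr (by omega)
  rw [Finset.sum_congr rfl fun a ha => show e (1 + s) 1 (1 + a) 1 =
      e (1 + s) 0 (1 + a) 0 - e (1 + s) 0 N 0 by
    have := h.same_column hN (s := s) (a := a) (b := N - 1) (τ := 1) (by omega)
      (by simpa using ha) (by omega) (by omega) (by omega)
    rw [show 1 + (N - 1) = N by omega,
      h.interior_last hN hs (by omega) (by omega) (by omega) (by omega)] at this
    linear_combination this, Finset.sum_sub_distrib, h0] at h1
  simpa [hN0] using h1

/-- With a reference point in column `1` the mixed terms vanish by decoupling. What remains is the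
entry plus a diagonal value at the reference point, so a unit shift changes all entries by the same
`δ`. -/
theorem column_zero_shift (hN : 2 ≤ N) (h : Rigid N e c) : ∃ δ : ℂ, ∀ s a, s < N → a < N →
    e (1 + (s + 1) % N) 0 (1 + (a + 1) % N) 0 = e (1 + s) 0 (1 + a) 0 + δ := by
  refine ⟨e (1 + 0) 1 (1 + 0) 1 - e (1 + (0 + 1) % N) 1 (1 + (0 + 1) % N) 1,
    fun s a hs ha => ?_⟩
  have hm : ∀ x, x % N < N := fun x => Nat.mod_lt _ (by omega)
  have key := h.shift 1 0 s 0 0 1 a 0 0 1 hs (by omega) (by omega) (by omega) ha (by omega)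
    (by omega) (by omega)
  simp only [add_zero, Nat.zero_mod, Nat.mod_eq_of_lt (show 1 < N by omega), altSum] at key
  have d1 : ∀ x y, x < N → y < N → e (1 + x) 0 (1 + y) 1 = 0 := fun x y hx hy =>
    h.dec_left hN hx (by omega) (by omega) (Or.inr one_pos)
  have d2 : ∀ x y, x < N → y < N → e (1 + x) 1 (1 + y) 0 = 0 := fun x y hx hy =>
    h.dec_right hN hy (by omega) (by omega) (Or.inr one_pos)
  have k1 := d1 ((s + 1) % N) 1 (hm _) (by omega)
  have k2 := d2 1 ((a + 1) % N) (by omega) (hm _)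
  have k3 := d1 s 0 hs (by omega)
  have k4 := d2 0 a (by omega) ha
  simp only [add_zero, zero_add, Nat.mod_eq_of_lt (show 1 < N by omega)] at key k3 k4 ⊢
  linear_combination key + k1 + k2 - k3 - k4

/-- After `N` unit shifts the entry returns to itself, so `N δ = 0`: the kernel on column `0` is
circulant. -/
theorem column_zero_shift_iterate (hN : 2 ≤ N) (h : Rigid N e c) {s a : ℕ} (hs : s < N)
    (ha : a < N) (ρ : ℕ) :
    e (1 + (s + ρ) % N) 0 (1 + (a + ρ) % N) 0 = e (1 + s) 0 (1 + a) 0 := by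
  obtain ⟨δ, hδ⟩ := h.column_zero_shift hN
  have hm : ∀ x, x % N < N := fun x => Nat.mod_lt _ (by omega)
  have iter : ∀ ρ : ℕ, e (1 + (s + ρ) % N) 0 (1 + (a + ρ) % N) 0 =
      e (1 + s) 0 (1 + a) 0 + ρ * δ := by
    intro ρ
    induction ρ with
    | zero => simp [Nat.mod_eq_of_lt, hs, ha]
    | succ ρ ih =>
      have := hδ _ _ (hm (s + ρ)) (hm (a + ρ))
      rw [Nat.mod_add_mod, Nat.mod_add_mod, ih] at this
      rw [← add_assoc, ← add_assoc, this]
      push_cast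
      ring
  have h0 := iter N
  rw [Nat.add_mod_right, Nat.add_mod_right, Nat.mod_eq_of_lt hs, Nat.mod_eq_of_lt ha] at h0
  have hN0 : (N : ℂ) ≠ 0 := Nat.cast_ne_zero.mpr (by omega)
  have : δ = 0 := by simpa [hN0] using h0
  rw [iter, this, mul_zero, add_zero]

/-- A circulant kernel is determined by its entries against row `N`; `column_last` kills the
off-diagonal ones, and the column sum gives the diagonal. -/
theorem column_zero (hN : 2 ≤ N) (h : Rigid N e c) {s a : ℕ} (hs : s < N) (ha : a < N) :
    e (1 + s) 0 (1 + a) 0 = if s = a then c else 0 := by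
  have off : ∀ s a, s < N → a < N → s ≠ a → e (1 + s) 0 (1 + a) 0 = 0 := by
    intro s a hs ha hsa
    rw [← h.column_zero_shift_iterate hN hs ha (N - 1 - a), show a + (N - 1 - a) = N - 1 by omega,
      Nat.mod_eq_of_lt (show N - 1 < N by omega), show 1 + (N - 1) = N by omega]
    refine h.column_last hN ?_
    rcases lt_or_ge s a with h1 | h1
    · rw [Nat.mod_eq_of_lt (by omega)]
      omega
    · rw [Nat.mod_eq_sub_mod (by omega), Nat.mod_eq_of_lt (by omega)]
      omega
  split_ifs with hsa
  · subst hsa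
    rw [← h.sum_column hN hs (show 0 < N by omega) (Or.inl rfl)]
    rw [Finset.sum_eq_single s]
    · intro b hb hne
      exact off s b hs (by simpa using hb) hne.symm
    · simp [hs]
  · exact off s a hs ha hsa

/-- A rigid kernel is scalar on `[1, N] × [0, N - 1]`. -/
theorem eq_on_upper (hN : 2 ≤ N) (h : Rigid N e c) {s t a τ : ℕ} (hs : s < N) (ht : t < N)
    (ha : a < N) (hτ : τ < N) :
    e (1 + s) t (1 + a) τ = if s = a ∧ t = τ then c else 0 := by
  by_cases htτ : t = τ
  · subst htτ
    simp only [and_true]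
    rcases Nat.eq_zero_or_pos t with rfl | ht0
    · exact h.column_zero hN hs ha
    rcases lt_or_ge (1 + s) N with h1 | h1
    · have := h.same_column hN hs ha (b := N - 1) (by omega) ht ht0
      rw [h.column_zero hN hs ha, h.column_zero hN hs (by omega), if_neg (c := s = N - 1) (by omega),
        show 1 + (N - 1) = N by omega, h.interior_last hN h1 ht ht0 ht.le ht0] at this
      simpa using this
    · have := h.same_column hN hs ha (b := 0) (by omega) ht ht0
      rw [h.column_zero hN hs ha, h.column_zero hN hs (by omega), if_neg (c := s = 0) (by omega)]
        at this
      have h2 : e (1 + s) t (1 + 0) t = 0 := by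
        rw [show 1 + s = N by omega]
        exact h.last_interior hN (by omega) ht ht0 ht.le ht0
      rw [h2] at this
      simpa using this
  · rw [h.off_column_eq_zero hN hs ht ha hτ htτ, if_neg fun h => htτ h.2]

/-- A rigid kernel is scalar on `[0, N - 1] × [1, N]`. -/
theorem eq_on_lower (hN : 2 ≤ N) (h : Rigid N e c) {s t a τ : ℕ} (hs : s < N) (ht : t < N)
    (ha : a < N) (hτ : τ < N) :
    e s (1 + t) a (1 + τ) = if s = a ∧ t = τ then c else 0 := by
  have := (h.reflect hN).eq_on_upper hN (s := N - 1 - s) (t := N - 1 - t) (a := N - 1 - a)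
    (τ := N - 1 - τ) (by omega) (by omega) (by omega) (by omega)
  simp only [show ∀ x, x < N → N - (1 + (N - 1 - x)) = x by intro x hx; omega, hs, ha,
    show ∀ x, x < N → N - (N - 1 - x) = 1 + x by intro x hx; omega, ht, hτ] at this
  rw [this]
  exact if_congr (by omega) rfl rfl

/-- The corner `(0, 0)` lies in neither of the two squares. Its entries are recovered from the row
and column sums along side `1`, where all other entries are already known. -/
theorem eq_on_first_side (hN : 2 ≤ N) (h : Rigid N e c) {z z' : ℕ} (hz : z < N) (hz' : z' < N) :
    e 0 z 0 z' = if z = z' then c else 0 := by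
  have pos : ∀ z z', 0 < z → z ≤ N → 0 < z' → z' ≤ N →
      e 0 z 0 z' = if z = z' then c else 0 := by
    intro z z' h1 h2 h3 h4
    have := h.eq_on_lower hN (s := 0) (a := 0) (t := z - 1) (τ := z' - 1) (by omega) (by omega)
      (by omega) (by omega)
    rw [show 1 + (z - 1) = z by omega, show 1 + (z' - 1) = z' by omega] at this
    rw [this]
    exact if_congr (by omega) rfl rfl
  have s1 : ∀ z, z < N → side N 0 z = 1 := fun z hz => if_pos ⟨rfl, hz⟩
  have s2 : ∀ y z, 0 < y ∨ z = N → side N y z ≠ 1 := by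
    intro y z hy
    unfold side
    split_ifs <;> omega
  have row : ∀ z, z < N → ∑ t ∈ Finset.range N, e 0 z 0 t = c := by
    intro z hz
    have d : ∀ y t, y ≤ N → t ≤ N → 0 < y ∨ t = N → e 0 z y t = 0 := fun y t hy ht hyt =>
      h.dec _ _ _ _ (by omega) (by omega) hy ht (by rw [s1 z hz]; exact (s2 y t hyt).symm)
    have hz0 : ∑ y ∈ Finset.range N, ∑ t ∈ Finset.range (N + 1), e 0 z (y + 1) t = 0 := by
      refine Finset.sum_eq_zero fun y hy => Finset.sum_eq_zero fun t ht =>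
        d _ _ ?_ ?_ (Or.inl y.succ_pos)
      · simpa [Nat.succ_le_iff] using hy
      · simpa [Nat.lt_succ_iff] using ht
    rw [← h.row 0 z (by omega) (by omega), Finset.sum_range_succ', Finset.sum_range_succ _ N,
      d 0 N (by omega) le_rfl (Or.inr rfl), hz0, zero_add, add_zero]
  have col : ∀ z, z < N → ∑ t ∈ Finset.range N, e 0 t 0 z = c := by
    intro z hz
    have d : ∀ y t, y ≤ N → t ≤ N → 0 < y ∨ t = N → e y t 0 z = 0 := fun y t hy ht hyt =>
      h.dec _ _ _ _ hy ht (by omega) (by omega) (by rw [s1 z hz]; exact (s2 y t hyt))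
    have hz0 : ∑ y ∈ Finset.range N, ∑ t ∈ Finset.range (N + 1), e (y + 1) t 0 z = 0 := by
      refine Finset.sum_eq_zero fun y hy => Finset.sum_eq_zero fun t ht =>
        d _ _ ?_ ?_ (Or.inl y.succ_pos)
      · simpa [Nat.succ_le_iff] using hy
      · simpa [Nat.lt_succ_iff] using ht
    rw [← h.col 0 z (by omega) (by omega), Finset.sum_range_succ', Finset.sum_range_succ _ N,
      d 0 N (by omega) le_rfl (Or.inr rfl), hz0, zero_add, add_zero]
  obtain ⟨M, rfl⟩ : ∃ M, N = M + 1 := ⟨N - 1, by omega⟩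
  have hz0 : ∀ z, 0 < z → z < M + 1 → e 0 z 0 0 = 0 := by
    intro z h1 h2
    have := row z h2
    rw [Finset.sum_range_succ', Finset.sum_eq_single (z - 1), show z - 1 + 1 = z by omega,
      pos z z h1 h2.le h1 h2.le, if_pos rfl] at this
    · simpa using this
    · intro t ht hne
      rw [Finset.mem_range] at ht
      rw [pos _ _ h1 h2.le (by omega) (by omega), if_neg (by omega)]
    · intro hn
      exact absurd (Finset.mem_range.mpr (by omega)) hn
  have h0z : ∀ z, 0 < z → z < M + 1 → e 0 0 0 z = 0 := by
    intro z h1 h2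
    have := col z h2
    rw [Finset.sum_range_succ', Finset.sum_eq_single (z - 1), show z - 1 + 1 = z by omega,
      pos z z h1 h2.le h1 h2.le, if_pos rfl] at this
    · simpa using this
    · intro t ht hne
      rw [Finset.mem_range] at ht
      rw [pos _ _ (by omega) (by omega) h1 h2.le, if_neg (by omega)]
    · intro hn
      exact absurd (Finset.mem_range.mpr (by omega)) hn
  rcases Nat.eq_zero_or_pos z with rfl | hz0'
  · rcases Nat.eq_zero_or_pos z' with rfl | hz1
    · have := row 0 hz
      rw [Finset.sum_range_succ', Finset.sum_eq_zero, zero_add] at this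
      · simpa using this
      · intro t ht
        exact h0z _ (by omega) (by simpa using ht)
    · rw [h0z z' hz1 hz', if_neg (by omega)]
  · rcases Nat.eq_zero_or_pos z' with rfl | hz1
    · rw [hz0 z hz0' hz, if_neg (by omega)]
    · exact pos z z' hz0' hz.le hz1 hz'.le

/-- A rigid kernel is scalar. -/
theorem eq_scalar (hN : 2 ≤ N) (h : Rigid N e c) {y z y' z' : ℕ} (hy : y ≤ N) (hz : z ≤ N)
    (hy' : y' ≤ N) (hz' : z' ≤ N) : e y z y' z' = if y = y' ∧ z = z' then c else 0 := by
  by_cases hside : side N y z = side N y' z'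
  · by_cases h1 : 1 ≤ y ∧ z < N ∧ 1 ≤ y' ∧ z' < N
    · have := h.eq_on_upper hN (s := y - 1) (t := z) (a := y' - 1) (τ := z') (by omega) (by omega)
        (by omega) (by omega)
      rw [show 1 + (y - 1) = y by omega, show 1 + (y' - 1) = y' by omega] at this
      rw [this]
      exact if_congr (by omega) rfl rfl
    by_cases h2 : 1 ≤ z ∧ y < N ∧ 1 ≤ z' ∧ y' < N
    · have := h.eq_on_lower hN (s := y) (t := z - 1) (a := y') (τ := z' - 1) (by omega) (by omega)
        (by omega) (by omega)
      rw [show 1 + (z - 1) = z by omega, show 1 + (z' - 1) = z' by omega] at this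
      rw [this]
      exact if_congr (by omega) rfl rfl
    by_cases h3 : y = 0 ∧ y' = 0 ∧ z < N ∧ z' < N
    · obtain ⟨rfl, rfl, h4, h5⟩ := h3
      rw [h.eq_on_first_side hN h4 h5]
      exact if_congr (by omega) rfl rfl
    -- The only case left is two points of side `3`, at least one of them the corner `(N, N)`;
    -- reflection maps it to side `1`.
    have h4 : y = N ∧ y' = N ∧ 0 < z ∧ 0 < z' := by
      unfold side at hside
      split_ifs at hside <;> omega
    obtain ⟨rfl, rfl, h5, h6⟩ := h4
    have := (h.reflect hN).eq_on_first_side hN (z := y' - z) (z' := y' - z') (by omega) (by omega)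
    simp only [Nat.sub_zero, show y' - (y' - z) = z by omega, show y' - (y' - z') = z' by omega]
      at this
    rw [this]
    exact if_congr (by omega) rfl rfl
  · rw [h.dec y z y' z' hy hz hy' hz' hside, if_neg]
    rintro ⟨rfl, rfl⟩
    exact hside rfl

end Rigid

end StrongUPB

/-! ### From orthogonality relations to rigid kernels -/

namespace StrongUPB

/-- Lower corners of the two basic boxes in the `k`-th shell. -/
def baseLo (d k : ℕ) (σ : Fin 2) : Fin 3 → ℕ :=
  if σ = 0 then ![k + 1, k, k] else ![k + 1, k, d - 1 - k]

/-- Side lengths (minus one) of the two basic boxes in the `k`-th shell. -/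
def baseLen (d k : ℕ) (σ : Fin 2) : Fin 3 → ℕ :=
  if σ = 0 then ![d - 2 - 2 * k, 0, d - 2 - 2 * k] else ![d - 2 - 2 * k, d - 2 - 2 * k, 0]

/-- Membership in a box of the outermost shell of `[0, N]³`: the basic box of type `β.1`, rotated
by `β.2`. -/
def InShell (N : ℕ) (β : Fin 2 × Fin 3) (x y z : ℕ) : Prop :=
  ∀ q : Fin 3, baseLo (N + 1) 0 β.1 (q - β.2) ≤ (![x, y, z] : Fin 3 → ℕ) q ∧
    (![x, y, z] : Fin 3 → ℕ) q ≤ baseLo (N + 1) 0 β.1 (q - β.2) + baseLen (N + 1) 0 β.1 (q - β.2)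

section InShell

variable {N x y z : ℕ}

theorem inShell_a₁ (hN : 2 ≤ N) : InShell N (0, 0) x y z ↔ 1 ≤ x ∧ x ≤ N ∧ y = 0 ∧ z < N := by
  simp [InShell, baseLo, baseLen, Fin.forall_fin_succ]
  omega

theorem inShell_b₂ (hN : 2 ≤ N) : InShell N (0, 1) x y z ↔ x < N ∧ 1 ≤ y ∧ y ≤ N ∧ z = 0 := by
  simp [InShell, baseLo, baseLen, Fin.forall_fin_succ, show (2 : Fin 3) - 1 = 1 from rfl,
    show (-1 : Fin 3) = 2 from rfl]
  omega

theorem inShell_b₃ (hN : 2 ≤ N) : InShell N (0, 2) x y z ↔ x = 0 ∧ y < N ∧ 1 ≤ z ∧ z ≤ N := by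
  simp [InShell, baseLo, baseLen, Fin.forall_fin_succ, show (1 : Fin 3) - 2 = 2 from rfl,
    show (-2 : Fin 3) = 1 from rfl]
  omega

theorem inShell_a₂ (hN : 2 ≤ N) : InShell N (1, 0) x y z ↔ 1 ≤ x ∧ x ≤ N ∧ y < N ∧ z = N := by
  simp [InShell, baseLo, baseLen, Fin.forall_fin_succ]
  omega

theorem inShell_a₃ (hN : 2 ≤ N) : InShell N (1, 1) x y z ↔ x = N ∧ 1 ≤ y ∧ y ≤ N ∧ z < N := by
  simp [InShell, baseLo, baseLen, Fin.forall_fin_succ, show (2 : Fin 3) - 1 = 1 from rfl,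
    show (-1 : Fin 3) = 2 from rfl]
  omega

theorem inShell_b₁ (hN : 2 ≤ N) : InShell N (1, 2) x y z ↔ x < N ∧ y = N ∧ 1 ≤ z ∧ z ≤ N := by
  simp [InShell, baseLo, baseLen, Fin.forall_fin_succ, show (1 : Fin 3) - 2 = 2 from rfl,
    show (-2 : Fin 3) = 1 from rfl]
  omega

end InShell

/-- The kernel `𝟙 ⊗ e` on `[0, N]³`. -/
def extendKernel (e : ℕ → ℕ → ℕ → ℕ → ℂ) (x y z x' y' z' : ℕ) : ℂ :=
  if x = x' then e y z y' z' else 0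

/-- The relations that orthogonality preservation imposes on a kernel `e`. -/
structure OrthoKernel (N : ℕ) (e : ℕ → ℕ → ℕ → ℕ → ℂ) : Prop where
  quad : ∀ β β', β ≠ β' → ∀ x y z x₀ y₀ z₀ a b c a₀ b₀ c₀, InShell N β x y z →
    InShell N β x₀ y₀ z₀ → InShell N β' a b c → InShell N β' a₀ b₀ c₀ →
    extendKernel e x y z a b c - extendKernel e x₀ y₀ z₀ a b c -
      extendKernel e x y z a₀ b₀ c₀ + extendKernel e x₀ y₀ z₀ a₀ b₀ c₀ = 0
  row : ∀ β x y z x₀ y₀ z₀, InShell N β x y z → InShell N β x₀ y₀ z₀ →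
    ∑ y' ∈ Finset.range (N + 1), ∑ z' ∈ Finset.range (N + 1), e y z y' z' =
    ∑ y' ∈ Finset.range (N + 1), ∑ z' ∈ Finset.range (N + 1), e y₀ z₀ y' z'
  col : ∀ β x y z x₀ y₀ z₀, InShell N β x y z → InShell N β x₀ y₀ z₀ →
    ∑ y' ∈ Finset.range (N + 1), ∑ z' ∈ Finset.range (N + 1), e y' z' y z =
    ∑ y' ∈ Finset.range (N + 1), ∑ z' ∈ Finset.range (N + 1), e y' z' y₀ z₀
  shift : ∀ ρ ρ' s t s₀ t₀ a b a₀ b₀, s < N → t < N → s₀ < N → t₀ < N → a < N → b < N →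
    a₀ < N → b₀ < N →
    altSum e (1 + (s + ρ) % N) ((t + ρ') % N) (1 + (s₀ + ρ) % N) ((t₀ + ρ') % N)
      (1 + (a + ρ) % N) ((b + ρ') % N) (1 + (a₀ + ρ) % N) ((b₀ + ρ') % N) =
    altSum e (1 + s) t (1 + s₀) t₀ (1 + a) b (1 + a₀) b₀
  shift' : ∀ ρ ρ' s t s₀ t₀ a b a₀ b₀, s < N → t < N → s₀ < N → t₀ < N → a < N → b < N →
    a₀ < N → b₀ < N →
    altSum e ((s + ρ) % N) (1 + (t + ρ') % N) ((s₀ + ρ) % N) (1 + (t₀ + ρ') % N)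
      ((a + ρ) % N) (1 + (b + ρ') % N) ((a₀ + ρ) % N) (1 + (b₀ + ρ') % N) =
    altSum e s (1 + t) s₀ (1 + t₀) a (1 + b) a₀ (1 + b₀)

/-- The box of the outermost shell that projects to a given side of the square. -/
def sideBox (i : ℕ) : Fin 2 × Fin 3 :=
  if i = 1 then (0, 0) else if i = 2 then (1, 0) else if i = 3 then (1, 2) else (0, 1)

/-- The box over a side is long in the `x` direction: `x` runs over `[1, N]` for sides `1`, `2` and
over `[0, N-1]` for sides `3`, `4`. Two heights over the same point are recorded, `x = 1` being
common to all four boxes. -/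
theorem inShell_sideBox {N y z : ℕ} (hN : 2 ≤ N) (hy : y ≤ N) (hz : z ≤ N)
    (h : side N y z ≠ 0) : InShell N (sideBox (side N y z)) 1 y z ∧
      InShell N (sideBox (side N y z)) (if side N y z ≤ 2 then N else 0) y z := by
  unfold side at h ⊢
  split_ifs <;> simp_all [sideBox, inShell_a₁, inShell_a₂, inShell_b₁, inShell_b₂] <;> omega

theorem sideBox_injOn {N y z y' z' : ℕ} (h : side N y z ≠ 0) (h' : side N y' z' ≠ 0)
    (hne : side N y z ≠ side N y' z') : sideBox (side N y z) ≠ sideBox (side N y' z') := by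
  have key : ∀ i < 5, ∀ j < 5, i ≠ 0 → j ≠ 0 → i ≠ j → sideBox i ≠ sideBox j := by
    intro i hi j hj
    interval_cases i <;> interval_cases j <;> simp [sideBox]
  have lt : ∀ y z, side N y z < 5 := by
    intro y z
    unfold side
    split_ifs <;> omega
  exact key _ (lt y z) _ (lt y' z') h h' hne

theorem interior_of_side_eq_zero {N y z : ℕ} (hN : 2 ≤ N) (hy : y ≤ N) (hz : z ≤ N)
    (h : side N y z = 0) : 1 ≤ y ∧ y < N ∧ 1 ≤ z ∧ z < N := by
  unfold side at h
  split_ifs at h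
  omega

namespace OrthoKernel

variable {N : ℕ} {e : ℕ → ℕ → ℕ → ℕ → ℂ}

theorem transpose (h : OrthoKernel N e) : OrthoKernel N (fun y z y' z' => e y' z' y z) where
  quad β β' hβ x y z x₀ y₀ z₀ a b c a₀ b₀ c₀ h1 h2 h3 h4 := by
    have := h.quad β' β hβ.symm a b c a₀ b₀ c₀ x y z x₀ y₀ z₀ h3 h4 h1 h2
    simp only [extendKernel, eq_comm (a := x), eq_comm (a := x₀)] at this ⊢
    linear_combination this
  row := h.col
  col := h.row
  shift ρ ρ' s t s₀ t₀ a b a₀ b₀ hs ht hs₀ ht₀ ha hb ha₀ hb₀ := by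
    have := h.shift ρ ρ' a b a₀ b₀ s t s₀ t₀ ha hb ha₀ hb₀ hs ht hs₀ ht₀
    simp only [altSum] at this ⊢
    linear_combination this
  shift' ρ ρ' s t s₀ t₀ a b a₀ b₀ hs ht hs₀ ht₀ ha hb ha₀ hb₀ := by
    have := h.shift' ρ ρ' a b a₀ b₀ s t s₀ t₀ ha hb ha₀ hb₀ hs ht hs₀ ht₀
    simp only [altSum] at this ⊢
    linear_combination this

/-- Take two heights over each point. In the four-term relation equal heights contribute `e` and
unequal ones zero, so the relation reads `e = 0` or `2 e = 0`. -/
theorem eq_zero_of_sides (hN : 2 ≤ N) (h : OrthoKernel N e) {y z y' z' : ℕ} (hy : y ≤ N)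
    (hz : z ≤ N) (hy' : y' ≤ N) (hz' : z' ≤ N) (h0 : side N y z ≠ 0) (h0' : side N y' z' ≠ 0)
    (hne : side N y z ≠ side N y' z') : e y z y' z' = 0 := by
  obtain ⟨h1, h2⟩ := inShell_sideBox hN hy hz h0
  obtain ⟨h1', h2'⟩ := inShell_sideBox hN hy' hz' h0'
  have key := h.quad _ _ (sideBox_injOn h0 h0' hne) _ _ _ _ _ _ _ _ _ _ _ _ h1 h2 h1' h2'
  have n1 : N ≠ 1 := by omega
  have n0 : N ≠ 0 := by omega
  by_cases hs : side N y z ≤ 2 <;> by_cases hs' : side N y' z' ≤ 2 <;>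
    simpa [extendKernel, hs, hs', n1, n1.symm, n0, n0.symm] using key

/-- An interior point lies under the flat boxes at `x = N` and `x = 0`. Use the one whose height
occurs over the given side, and compare inside it with a boundary point already known to be
decoupled from that side. -/
theorem eq_zero_of_interior (hN : 2 ≤ N) (h : OrthoKernel N e) {y z y' z' : ℕ} (hy : y ≤ N)
    (hz : z ≤ N) (hy' : y' ≤ N) (hz' : z' ≤ N) (h0 : side N y z = 0) (h0' : side N y' z' ≠ 0) :
    e y z y' z' = 0 := by
  obtain ⟨i1, i2, i3, i4⟩ := interior_of_side_eq_zero hN hy hz h0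
  obtain ⟨h1', h2'⟩ := inShell_sideBox hN hy' hz' h0'
  by_cases hs : side N y' z' ≤ 2
  · rw [if_pos hs] at h2'
    have hcorner : side N N 0 = 4 := by
      unfold side
      split_ifs <;> omega
    have key := h.quad (1, 1) (sideBox (side N y' z')) (by unfold sideBox; split_ifs <;> decide)
      N y z N N 0 N y' z' 1 y' z' ((inShell_a₃ hN).mpr ⟨rfl, i1, hy, i4⟩)
      ((inShell_a₃ hN).mpr ⟨rfl, by omega, le_rfl, by omega⟩) h2' h1'
    have hz0 : e N 0 y' z' = 0 := h.eq_zero_of_sides hN le_rfl (by omega) hy' hz'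
      (by omega) h0' (by omega)
    simp only [extendKernel, if_neg (show N ≠ 1 by omega), if_true, hz0] at key
    simpa using key
  · rw [if_neg hs] at h2'
    have hcorner : side N 0 1 = 1 := by
      unfold side
      split_ifs <;> omega
    have key := h.quad (0, 2) (sideBox (side N y' z')) (by unfold sideBox; split_ifs <;> decide)
      0 y z 0 0 1 0 y' z' 1 y' z' ((inShell_b₃ hN).mpr ⟨rfl, i2, i3, hz⟩)
      ((inShell_b₃ hN).mpr ⟨rfl, by omega, le_rfl, by omega⟩) h2' h1'
    have hz0 : e 0 1 y' z' = 0 := h.eq_zero_of_sides hN (by omega) (by omega) hy' hz'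
      (by omega) h0' (by omega)
    simp only [extendKernel, if_neg (show 0 ≠ 1 by omega), if_true, hz0] at key
    simpa using key

/-- Row sums are constant on the projection of each box. The two squares share `(1, 1)`, and the
corners `(0, 0)` and `(N, N)` are linked to them along sides `1` and `3`. -/
theorem row_eq (hN : 2 ≤ N) (h : OrthoKernel N e) {y z : ℕ} (hy : y ≤ N) (hz : z ≤ N) :
    ∑ y' ∈ Finset.range (N + 1), ∑ z' ∈ Finset.range (N + 1), e y z y' z' =
    ∑ y' ∈ Finset.range (N + 1), ∑ z' ∈ Finset.range (N + 1), e 1 1 y' z' := by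
  by_cases h1 : 1 ≤ y ∧ z < N
  · exact h.row (1, 1) N y z N 1 1 ((inShell_a₃ hN).mpr ⟨rfl, h1.1, hy, h1.2⟩)
      ((inShell_a₃ hN).mpr ⟨rfl, le_rfl, by omega, by omega⟩)
  by_cases h2 : y < N ∧ 1 ≤ z
  · exact h.row (0, 2) 0 y z 0 1 1 ((inShell_b₃ hN).mpr ⟨rfl, h2.1, h2.2, hz⟩)
      ((inShell_b₃ hN).mpr ⟨rfl, by omega, le_rfl, by omega⟩)
  by_cases h3 : y = 0
  · rw [h.row (0, 0) 1 y z 1 0 1 ((inShell_a₁ hN).mpr ⟨le_rfl, by omega, h3, by omega⟩)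
      ((inShell_a₁ hN).mpr ⟨le_rfl, by omega, rfl, by omega⟩)]
    exact h.row (0, 2) 0 0 1 0 1 1 ((inShell_b₃ hN).mpr ⟨rfl, by omega, le_rfl, by omega⟩)
      ((inShell_b₃ hN).mpr ⟨rfl, by omega, le_rfl, by omega⟩)
  · rw [h.row (1, 2) 1 y z 1 N 1 ((inShell_b₁ hN).mpr ⟨by omega, by omega, by omega, hz⟩)
      ((inShell_b₁ hN).mpr ⟨by omega, rfl, by omega, by omega⟩)]
    exact h.row (1, 1) N N 1 N 1 1 ((inShell_a₃ hN).mpr ⟨rfl, by omega, le_rfl, by omega⟩)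
      ((inShell_a₃ hN).mpr ⟨rfl, le_rfl, by omega, by omega⟩)

/-- Column sums are constant by transposition; summing the whole kernel in both orders shows that
the two constants agree. -/
theorem rigid (hN : 2 ≤ N) (h : OrthoKernel N e) : ∃ c, Rigid N e c := by
  refine ⟨∑ y' ∈ Finset.range (N + 1), ∑ z' ∈ Finset.range (N + 1), e 1 1 y' z',
    ⟨?_, fun y z hy hz => h.row_eq hN hy hz, ?_, h.shift, h.shift'⟩⟩
  · intro y z y' z' hy hz hy' hz' hne
    by_cases h0 : side N y z = 0
    · exact h.eq_zero_of_interior hN hy hz hy' hz' h0 (by omega)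
    by_cases h0' : side N y' z' = 0
    · exact h.transpose.eq_zero_of_interior hN hy' hz' hy hz h0' h0
    · exact h.eq_zero_of_sides hN hy hz hy' hz' h0 h0' hne
  · have hcol := fun y z hy hz => h.transpose.row_eq hN (y := y) (z := z) hy hz
    have mem : ∀ {x}, x ∈ Finset.range (N + 1) → x ≤ N := fun hx => by
      simpa [Nat.lt_succ_iff] using hx
    have total : ∑ y ∈ Finset.range (N + 1), ∑ z ∈ Finset.range (N + 1),
        ∑ y' ∈ Finset.range (N + 1), ∑ z' ∈ Finset.range (N + 1), e y z y' z' =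
        ∑ y ∈ Finset.range (N + 1), ∑ z ∈ Finset.range (N + 1),
        ∑ y' ∈ Finset.range (N + 1), ∑ z' ∈ Finset.range (N + 1), e 1 1 y' z' :=
      Finset.sum_congr rfl fun y hy => Finset.sum_congr rfl fun z hz =>
        h.row_eq hN (mem hy) (mem hz)
    have total' : ∑ y ∈ Finset.range (N + 1), ∑ z ∈ Finset.range (N + 1),
        ∑ y' ∈ Finset.range (N + 1), ∑ z' ∈ Finset.range (N + 1), e y' z' y z =
        ∑ y ∈ Finset.range (N + 1), ∑ z ∈ Finset.range (N + 1),
        ∑ y' ∈ Finset.range (N + 1), ∑ z' ∈ Finset.range (N + 1), e y' z' 1 1 :=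
      Finset.sum_congr rfl fun y hy => Finset.sum_congr rfl fun z hz =>
        hcol y z (mem hy) (mem hz)
    have swap : ∑ y ∈ Finset.range (N + 1), ∑ z ∈ Finset.range (N + 1),
        ∑ y' ∈ Finset.range (N + 1), ∑ z' ∈ Finset.range (N + 1), e y z y' z' =
        ∑ y ∈ Finset.range (N + 1), ∑ z ∈ Finset.range (N + 1),
        ∑ y' ∈ Finset.range (N + 1), ∑ z' ∈ Finset.range (N + 1), e y' z' y z := by
      have pair : ∀ g : ℕ → ℕ → ℂ,
          ∑ y ∈ Finset.range (N + 1), ∑ z ∈ Finset.range (N + 1), g y z =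
          ∑ p ∈ Finset.range (N + 1) ×ˢ Finset.range (N + 1), g p.1 p.2 := fun g =>
        (Finset.sum_product' _ _ _).symm
      simp only [pair]
      rw [Finset.sum_comm]
    rw [swap, total'] at total
    intro y z hy hz
    rw [hcol y z hy hz]
    have hN1 : (N : ℂ) + 1 ≠ 0 := Nat.cast_add_one_ne_zero N
    simp only [Finset.sum_const, Finset.card_range, nsmul_eq_mul] at total
    push_cast at total
    exact mul_left_cancel₀ hN1 (mul_left_cancel₀ hN1 total)

end OrthoKernel

end StrongUPB

/-! ### The boxes of the shells, their states and their number -/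

namespace StrongUPB

/-- The boxes of the shells, together with `e ≤ 1` central boxes of side length two. -/
def shellBoxes (d e : ℕ) (hd : 3 ≤ d) (he : e ≤ 1) (hev : 0 < e → d % 2 = 0) :
    BoxFamily (Fin 3) ((Fin ((d - 1) / 2) × Fin 2 × Fin 3) ⊕ Fin e) d where
  lo := Sum.elim (fun i q => baseLo d i.1 i.2.1 (q - i.2.2)) fun _ _ => (d - 2) / 2
  len := Sum.elim (fun i q => baseLen d i.1 i.2.1 (q - i.2.2)) fun _ _ => 1
  lt := by
    rintro (⟨k, σ, r⟩ | i) q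
    · have hk := k.2
      simp only [Sum.elim_inl]
      generalize q - r = q'
      fin_cases σ <;> fin_cases q' <;> simp [baseLo, baseLen] <;> omega
    · simp only [Sum.elim_inr]
      omega
  disj := by
    have in_out : ∀ (k : Fin ((d - 1) / 2)) (σ : Fin 2) (r : Fin 3), 0 < e → ∃ q : Fin 3,
        baseLo d k σ (q - r) + baseLen d k σ (q - r) < (d - 2) / 2 ∨
          (d - 2) / 2 + 1 < baseLo d k σ (q - r) := by
      intro k σ r h0
      have hk := k.2
      have := hev h0
      fin_cases σ
      -- The separating coordinate is the flat direction of the box: base coordinate `1` for the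
      -- first type, `2` for the second, rotated by `r`.
      · refine ⟨1 + r, Or.inl ?_⟩
        simp [baseLo, baseLen]
        omega
      · refine ⟨2 + r, Or.inr ?_⟩
        simp [baseLo]
        omega
    rintro (⟨k, σ, r⟩ | i) (⟨k', σ', r'⟩ | j) hne
    · have hk := k.2
      have hk' := k'.2
      have hne' : (k : ℕ) = k' → σ = σ' → r = r' → False := by
        rintro h rfl rfl
        exact hne (by rw [Fin.ext h])
      clear hne
      simp only [Sum.elim_inl]
      generalize (k : ℕ) = x at *
      generalize (k' : ℕ) = x' at *
      fin_cases σ <;> fin_cases σ' <;> fin_cases r <;> fin_cases r' <;>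
        simp [Fin.exists_fin_succ, baseLo, baseLen, show (-1 : Fin 3) = 2 from rfl,
          show (-2 : Fin 3) = 1 from rfl, show (2 : Fin 3) - 1 = 1 from rfl,
          show (1 : Fin 3) - 2 = 2 from rfl] at hne' ⊢ <;> omega
    · simpa using in_out k σ r (by have := j.2; omega)
    · simpa [or_comm] using in_out k' σ' r' (by have := i.2; omega)
    · have := i.2
      have := j.2
      exact absurd (congrArg Sum.inr (Fin.ext (by omega))) hne

/-- The product states of Fourier vectors with nontrivial label supported on a box. -/
def boxStates (d : ℕ) (lo len : Fin 3 → ℕ) : Set (State (Fin 3) d) :=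
  {ψ | ∃ a : Fin 3 → ℕ, (∀ q, a q ≤ len q) ∧ a ≠ 0 ∧
    ψ = productVec fun q => fourierKet d (lo q) (len q) (a q)}

theorem BoxFamily.states_eq_iUnion {ι : Type} {d : ℕ} (B : BoxFamily (Fin 3) ι d) :
    B.states = (⋃ i, boxStates d (B.lo i) (B.len i)) ∪ {allOnes (Fin 3) d} := by
  ext ψ
  simp only [states, Set.mem_union, Set.mem_iUnion, Set.mem_ofPred_eq, boxStates]
  refine or_congr (exists_congr fun i => ?_) Iff.rfl
  constructor
  · rintro ⟨a, ha, rfl⟩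
    refine ⟨fun q => a q, fun q => Nat.lt_succ_iff.mp (a q).2, fun h => ha ?_, rfl⟩
    funext q
    exact Fin.ext (congrFun h q)
  · rintro ⟨a, ha, ha0, rfl⟩
    refine ⟨fun q => ⟨a q, Nat.lt_succ_of_le (ha q)⟩, fun h => ha0 ?_, rfl⟩
    funext q
    exact congrArg Fin.val (congrFun h q)

/-- Here `p` and `q` are the parties carrying the labels `i` and `j`, and `s` is the party holding a
single ket, whose Fourier label is necessarily `0`. -/
theorem family_eq_boxStates {d n : ℕ} {f : ℕ → ℕ → State (Fin 3) d} {lo len : Fin 3 → ℕ}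
    (p q s : Fin 3) (hpq : p ≠ q) (hall : ∀ t, t = p ∨ t = q ∨ t = s) (hsp : s ≠ p) (hsq : s ≠ q)
    (hp : len p + 1 = n) (hq : len q + 1 = n) (hs : len s = 0)
    (hf : ∀ a : Fin 3 → ℕ, a s = 0 →
      f (a p) (a q) = productVec fun t => fourierKet d (lo t) (len t) (a t)) :
    family n f = boxStates d lo len := by
  ext ψ
  constructor
  · rintro ⟨i, j, hi, hj, hij, rfl⟩
    have h := hf (fun t => if t = p then i else if t = q then j else 0) (by simp [hsp, hsq])
    refine ⟨fun t => if t = p then i else if t = q then j else 0, fun t => ?_, fun h0 => hij ?_, ?_⟩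
    · rcases hall t with rfl | rfl | rfl
      · simp only [if_true]; omega
      · simp only [if_neg hpq.symm, if_true]; omega
      · simp [hsp, hsq]
    · have h1 := congrFun h0 p
      have h2 := congrFun h0 q
      simp only [if_true, if_neg hpq.symm, Pi.zero_apply] at h1 h2
      rw [h1, h2]
    · rw [← h]
      simp [hpq.symm]
  · rintro ⟨a, ha, ha0, rfl⟩
    have has : a s = 0 := by have := ha s; omega
    refine ⟨a p, a q, by have := ha p; omega, by have := ha q; omega, fun h => ha0 ?_,
      (hf a has).symm⟩
    rw [Prod.mk.injEq] at h
    funext t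
    rcases hall t with rfl | rfl | rfl
    · exact h.1
    · exact h.2
    · exact has

theorem ket_eq_fourierKet (d k : ℕ) : ket d k = fourierKet d k 0 0 := by
  simp [fourierKet]

theorem eta_eq_fourierKet {d k : ℕ} (hk : 2 * k + 2 ≤ d) (i : ℕ) :
    eta d k i = fourierKet d k (d - 2 - 2 * k) i := by
  have hIcc : Finset.Icc k (d - 2 - k) = Finset.Ico k (d - 1 - k) := by
    ext t
    simp only [Finset.mem_Icc, Finset.mem_Ico]
    omega
  rw [eta, fourierKet, hIcc, Finset.sum_Ico_eq_sum_range,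
    show d - 1 - k - k = d - 2 - 2 * k + 1 by omega, show d - 1 - 2 * k = d - 2 - 2 * k + 1 by omega,
    Fin.sum_univ_eq_sum_range (fun s => w (d - 2 - 2 * k + 1) ^ (i * s) • ket d (k + s))]
  simp

theorem xi_eq_fourierKet {d k : ℕ} (hk : 2 * k + 2 ≤ d) (i : ℕ) :
    xi d k i = fourierKet d (k + 1) (d - 2 - 2 * k) i := by
  have hIcc : Finset.Icc k (d - 2 - k) = Finset.Ico k (d - 1 - k) := by
    ext t
    simp only [Finset.mem_Icc, Finset.mem_Ico]
    omega
  rw [xi, fourierKet, hIcc, Finset.sum_Ico_eq_sum_range,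
    show d - 1 - k - k = d - 2 - 2 * k + 1 by omega, show d - 1 - 2 * k = d - 2 - 2 * k + 1 by omega,
    Fin.sum_univ_eq_sum_range (fun s => w (d - 2 - 2 * k + 1) ^ (i * s) • ket d (k + 1 + s))]
  simp [add_right_comm]

theorem phi_eq_fourierKet {d : ℕ} (hd : 2 ≤ d) (r : ℕ) :
    phi d r = fourierKet d ((d - 2) / 2) 1 r := by
  have hw : w (1 + 1) = -1 := by
    rw [w, show (2 * Real.pi * Complex.I / ((1 + 1 : ℕ) : ℂ)) = Real.pi * Complex.I by
      push_cast
      ring, Complex.exp_pi_mul_I]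
  rw [phi, fourierKet, hw, show d / 2 = (d - 2) / 2 + 1 by omega]
  simp

theorem A0_eq_boxStates {d : ℕ} (hd : 2 ≤ d) :
    A0 d = boxStates d (fun _ => (d - 2) / 2) fun _ => 1 := by
  have tri_eq : ∀ r s t, tri (phi d r) (phi d s) (phi d t) = productVec fun q =>
      fourierKet d ((d - 2) / 2) 1 ((![r, s, t] : Fin 3 → ℕ) q) := by
    intro r s t
    rw [tri]
    congr 1
    funext q
    fin_cases q <;> simp [phi_eq_fourierKet hd]
  ext ψ
  constructor
  · rintro ⟨r, s, t, hr, hs, ht, h0, rfl⟩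
    refine ⟨![r, s, t], fun q => ?_, fun h => h0 ?_, tri_eq r s t⟩
    · fin_cases q <;> simp <;> omega
    · have h1 := congrFun h 0
      have h2 := congrFun h 1
      have h3 := congrFun h 2
      simp_all
  · rintro ⟨a, ha, h0, rfl⟩
    refine ⟨a 0, a 1, a 2, by have : a 0 ≤ 1 := ha 0; omega, by have : a 1 ≤ 1 := ha 1; omega,
      by have : a 2 ≤ 1 := ha 2; omega, fun h => h0 ?_, ?_⟩
    · simp only [Prod.mk.injEq] at h
      funext q
      fin_cases q <;> simp [h]
    · rw [tri_eq]
      congr 1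
      funext q
      fin_cases q <;> rfl

theorem C_eq_iUnion {d k : ℕ} (hk : 2 * k + 2 ≤ d) :
    C d k = ⋃ β : Fin 2 × Fin 3, boxStates d (fun q => baseLo d k β.1 (q - β.2))
      fun q => baseLen d k β.1 (q - β.2) := by
  have n_eq : d - 2 - 2 * k + 1 = d - 1 - 2 * k := by omega
  have e1 : A1 d k = boxStates d (fun q => baseLo d k 0 (q - 0)) fun q => baseLen d k 0 (q - 0) := by
    refine family_eq_boxStates 2 0 1 (by decide) (by decide) (by decide) (by decide) n_eq n_eq rfl
      fun a ha => ?_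
    rw [tri]
    congr 1
    funext q
    fin_cases q <;> simp [baseLo, baseLen, eta_eq_fourierKet hk, xi_eq_fourierKet hk,
      ket_eq_fourierKet, ha]
  have e2 : A2 d k = boxStates d (fun q => baseLo d k 1 (q - 0)) fun q => baseLen d k 1 (q - 0) := by
    refine family_eq_boxStates 1 0 2 (by decide) (by decide) (by decide) (by decide) n_eq n_eq rfl
      fun a ha => ?_
    rw [tri]
    congr 1
    funext q
    fin_cases q <;> simp [baseLo, baseLen, eta_eq_fourierKet hk, xi_eq_fourierKet hk,
      ket_eq_fourierKet, ha]
  have e3 : A3 d k = boxStates d (fun q => baseLo d k 1 (q - 1)) fun q => baseLen d k 1 (q - 1) := by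
    refine family_eq_boxStates 2 1 0 (by decide) (by decide) (by decide) (by decide) n_eq n_eq rfl
      fun a ha => ?_
    rw [tri]
    congr 1
    funext q
    fin_cases q <;> simp [baseLo, baseLen, eta_eq_fourierKet hk, xi_eq_fourierKet hk,
      ket_eq_fourierKet, ha, show (-1 : Fin 3) = 2 from rfl, show (2 : Fin 3) - 1 = 1 from rfl]
  have e4 : B1 d k = boxStates d (fun q => baseLo d k 1 (q - 2)) fun q => baseLen d k 1 (q - 2) := by
    refine family_eq_boxStates 0 2 1 (by decide) (by decide) (by decide) (by decide) n_eq n_eq rfl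
      fun a ha => ?_
    rw [tri]
    congr 1
    funext q
    fin_cases q <;> simp [baseLo, baseLen, eta_eq_fourierKet hk, xi_eq_fourierKet hk,
      ket_eq_fourierKet, ha, show (-2 : Fin 3) = 1 from rfl, show (1 : Fin 3) - 2 = 2 from rfl]
  have e5 : B2 d k = boxStates d (fun q => baseLo d k 0 (q - 1)) fun q => baseLen d k 0 (q - 1) := by
    refine family_eq_boxStates 0 1 2 (by decide) (by decide) (by decide) (by decide) n_eq n_eq rfl
      fun a ha => ?_
    rw [tri]
    congr 1
    funext q
    fin_cases q <;> simp [baseLo, baseLen, eta_eq_fourierKet hk, xi_eq_fourierKet hk,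
      ket_eq_fourierKet, ha, show (-1 : Fin 3) = 2 from rfl, show (2 : Fin 3) - 1 = 1 from rfl]
  have e6 : B3 d k = boxStates d (fun q => baseLo d k 0 (q - 2)) fun q => baseLen d k 0 (q - 2) := by
    refine family_eq_boxStates 1 2 0 (by decide) (by decide) (by decide) (by decide) n_eq n_eq rfl
      fun a ha => ?_
    rw [tri]
    congr 1
    funext q
    fin_cases q <;> simp [baseLo, baseLen, eta_eq_fourierKet hk, xi_eq_fourierKet hk,
      ket_eq_fourierKet, ha, show (-2 : Fin 3) = 1 from rfl, show (1 : Fin 3) - 2 = 2 from rfl]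
  rw [C, e1, e2, e3, e4, e5, e6]
  ext ψ
  simp only [Set.mem_union, Set.mem_iUnion, Prod.exists, Fin.exists_fin_succ]
  simp [or_assoc]
  tauto

theorem stopper_eq_allOnes (d : ℕ) : stopper d = BoxFamily.allOnes (Fin 3) d := by
  rw [← BoxFamily.productVec_ones, stopper, tri]
  congr 1
  funext q
  fin_cases q <;> rfl

theorem oddSet_eq_states {d : ℕ} (hd : 3 ≤ d) (hodd : d % 2 = 1) :
    oddSet d = (shellBoxes d 0 hd (by omega) (by omega)).states := by
  rw [BoxFamily.states_eq_iUnion, oddSet, stopper_eq_allOnes]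
  congr 1
  ext ψ
  simp only [Set.mem_iUnion, Set.mem_Iic, Sum.exists, Prod.exists, IsEmpty.exists_iff, or_false,
    exists_prop]
  constructor
  · rintro ⟨k, hk, h⟩
    rw [C_eq_iUnion (by omega), Set.mem_iUnion] at h
    obtain ⟨⟨σ, r⟩, h⟩ := h
    exact ⟨⟨k, by omega⟩, σ, r, h⟩
  · rintro ⟨⟨k, hk⟩, σ, r, h⟩
    refine ⟨k, by omega, ?_⟩
    rw [C_eq_iUnion (by omega), Set.mem_iUnion]
    exact ⟨⟨σ, r⟩, h⟩

theorem evenSet_eq_states {d : ℕ} (hd : 3 ≤ d) (heven : d % 2 = 0) :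
    evenSet d = (shellBoxes d 1 hd le_rfl fun _ => heven).states := by
  rw [BoxFamily.states_eq_iUnion, evenSet, stopper_eq_allOnes, A0_eq_boxStates (by omega)]
  congr 1
  ext ψ
  simp only [Set.mem_union, Set.mem_iUnion, Set.mem_Iic, Sum.exists, Prod.exists, exists_prop]
  refine or_congr ⟨?_, ?_⟩ ⟨fun h => ⟨0, h⟩, fun ⟨_, h⟩ => h⟩
  · rintro ⟨k, hk, h⟩
    rw [C_eq_iUnion (by omega), Set.mem_iUnion] at h
    obtain ⟨⟨σ, r⟩, h⟩ := h
    exact ⟨⟨k, by omega⟩, σ, r, h⟩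
  · rintro ⟨⟨k, hk⟩, σ, r, h⟩
    refine ⟨k, by omega, ?_⟩
    rw [C_eq_iUnion (by omega), Set.mem_iUnion]
    exact ⟨⟨σ, r⟩, h⟩

/-- Shell `k + 1` of the larger cube has the size of shell `k` of the cube with side smaller by two,
so the induction splits off the outermost shell. -/
theorem sum_shell_card (K : ℕ) :
    (∑ k ∈ Finset.range K, (6 * ((2 * K + 1 - 1 - 2 * k : ℕ) ^ 2 - 1 : ℤ)) =
      (2 * K + 1 : ℤ) ^ 3 - 4 * (2 * K + 1) + 3) ∧
    (∑ k ∈ Finset.range K, (6 * ((2 * K + 2 - 1 - 2 * k : ℕ) ^ 2 - 1 : ℤ)) =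
      (2 * K + 2 : ℤ) ^ 3 - 4 * (2 * K + 2)) := by
  induction K with
  | zero => simp
  | succ K ih =>
    rw [Finset.sum_range_succ', Finset.sum_range_succ']
    simp only [show ∀ k, 2 * (K + 1) + 1 - 1 - 2 * (k + 1) = 2 * K + 1 - 1 - 2 * k by omega,
      show ∀ k, 2 * (K + 1) + 2 - 1 - 2 * (k + 1) = 2 * K + 2 - 1 - 2 * k by omega, ih]
    rw [show 2 * (K + 1) + 1 - 1 - 2 * 0 = 2 * K + 2 by omega,
      show 2 * (K + 1) + 2 - 1 - 2 * 0 = 2 * K + 3 by omega]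
    push_cast
    constructor <;> ring

theorem ncard_shellBoxes {d e : ℕ} (hd : 3 ≤ d) (he : e ≤ 1) (hev : 0 < e → d % 2 = 0) :
    ((shellBoxes d e hd he hev).states.ncard : ℤ) =
      ∑ k ∈ Finset.range ((d - 1) / 2), (6 * ((d - 1 - 2 * k : ℕ) ^ 2 - 1 : ℤ)) + 7 * e + 1 := by
  have : NeZero d := ⟨by omega⟩
  rw [BoxFamily.ncard_states, Fintype.sum_sum_type, Fintype.sum_prod_type]
  have h1 : ∀ (k : Fin ((d - 1) / 2)) (β : Fin 2 × Fin 3),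
      ∏ q, ((shellBoxes d e hd he hev).len (Sum.inl (k, β)) q + 1) = (d - 1 - 2 * k) ^ 2 := by
    rintro k ⟨σ, r⟩
    have hk := k.2
    simp only [shellBoxes, Sum.elim_inl]
    rw [Fintype.prod_equiv (Equiv.subRight r) _ (fun q => baseLen d k σ q + 1) (by simp),
      Fin.prod_univ_three, show d - 1 - 2 * (k : ℕ) = d - 2 - 2 * k + 1 by omega]
    fin_cases σ <;> simp [baseLen] <;> ring
  have h2 : ∀ i, ∏ q, ((shellBoxes d e hd he hev).len (Sum.inr i) q + 1) = 8 := by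
    intro i
    simp [shellBoxes]
  simp only [h1, h2]
  push_cast
  rw [← Fin.sum_univ_eq_sum_range (fun k => (6 * ((d - 1 - 2 * k : ℕ) ^ 2 - 1 : ℤ)))]
  congr 2
  · refine Finset.sum_congr rfl fun k _ => ?_
    have hk := k.2
    rw [Nat.cast_sub (Nat.one_le_pow _ _ (by omega))]
    simp
    ring
  · simp [mul_comm]

end StrongUPB

/-! ### Unextendibility -/

namespace StrongUPB

theorem BoxFamily.exists_cell {κ ι : Type} {d : ℕ} (B : BoxFamily κ ι d) {i : ι} {X : κ → Fin d}
    (h : ∀ q, B.lo i q ≤ X q ∧ (X q : ℕ) ≤ B.lo i q + B.len i q) : ∃ p, B.cell i p = X := by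
  refine ⟨fun q => ⟨X q - B.lo i q, by have := h q; omega⟩, ?_⟩
  funext q
  have := h q
  exact Fin.ext (by simp only [BoxFamily.cell]; omega)

/-- Extension of a vector by zero to all natural indices. -/
noncomputable def coord {d : ℕ} (v : EuclideanSpace ℂ (Fin d)) (x : ℕ) : ℂ :=
  if h : x < d then v ⟨x, h⟩ else 0

theorem sum_coord {d : ℕ} (v : EuclideanSpace ℂ (Fin d)) :
    ∑ x ∈ Finset.range d, coord v x = ∑ x, v x := by
  rw [← Fin.sum_univ_eq_sum_range]
  simp [coord]

section

variable {d e : ℕ} (hd : 3 ≤ d) (he : e ≤ 1) (hev : 0 < e → d % 2 = 0)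

/-- The `k`-th shell is the outermost shell of a cube with last index `d - 1 - 2k`, translated by
`k` in every direction. -/
theorem inShell_shift {k : ℕ} (hk : k < (d - 1) / 2) {β : Fin 2 × Fin 3} {x y z : ℕ}
    (h : InShell (d - 1 - 2 * k) β x y z) (q : Fin 3) :
    (shellBoxes d e hd he hev).lo (Sum.inl (⟨k, hk⟩, β)) q ≤
        (![k + x, k + y, k + z] : Fin 3 → ℕ) q ∧
      (![k + x, k + y, k + z] : Fin 3 → ℕ) q ≤
        (shellBoxes d e hd he hev).lo (Sum.inl (⟨k, hk⟩, β)) q +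
          (shellBoxes d e hd he hev).len (Sum.inl (⟨k, hk⟩, β)) q := by
  obtain ⟨σ, r⟩ := β
  have hv : (![k + x, k + y, k + z] : Fin 3 → ℕ) q = k + (![x, y, z] : Fin 3 → ℕ) q := by
    fin_cases q <;> rfl
  have hlo : ∀ q, baseLo d k σ q = k + baseLo (d - 1 - 2 * k + 1) 0 σ q := by
    intro q
    fin_cases σ <;> fin_cases q <;> simp [baseLo]
    omega
  have hlen : ∀ q, baseLen d k σ q = baseLen (d - 1 - 2 * k + 1) 0 σ q := by
    intro q
    fin_cases σ <;> fin_cases q <;> simp [baseLen] <;> omega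
  have := h q
  simp only [shellBoxes, Sum.elim_inl, hlo, hlen] at this ⊢
  rw [hv]
  omega

theorem not_isProductState_of_mem_orthogonal {ψ : State (Fin 3) d}
    (hψ : ψ ∈ (Submodule.span ℂ (shellBoxes d e hd he hev).states)ᗮ) (hcenter : d % 2 = 0 → 0 < e) :
    ¬ IsProductState ψ := by
  rintro ⟨hne, v, rfl⟩
  set a := coord (v 0) with ha
  set b := coord (v 1) with hb
  set c := coord (v 2) with hc
  have hval : ∀ {x y z : ℕ} (hx : x < d) (hy : y < d) (hz : z < d),
      a x * b y * c z = productVec v ![⟨x, hx⟩, ⟨y, hy⟩, ⟨z, hz⟩] := by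
    intro x y z hx hy hz
    simp [productVec, Fin.prod_univ_three, ha, hb, hc, coord, hx, hy, hz]
  have hconst : ∀ i {x y z x' y' z' : ℕ},
      (∀ q, (shellBoxes d e hd he hev).lo i q ≤ (![x, y, z] : Fin 3 → ℕ) q ∧
        (![x, y, z] : Fin 3 → ℕ) q ≤
          (shellBoxes d e hd he hev).lo i q + (shellBoxes d e hd he hev).len i q) →
      (∀ q, (shellBoxes d e hd he hev).lo i q ≤ (![x', y', z'] : Fin 3 → ℕ) q ∧
        (![x', y', z'] : Fin 3 → ℕ) q ≤
          (shellBoxes d e hd he hev).lo i q + (shellBoxes d e hd he hev).len i q) →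
      a x * b y * c z = a x' * b y' * c z' := by
    intro i x y z x' y' z' h h'
    have hlt := (shellBoxes d e hd he hev).lt i
    have lt : ∀ q, (![x, y, z] : Fin 3 → ℕ) q < d := fun q => (h q).2.trans_lt (hlt q)
    have lt' : ∀ q, (![x', y', z'] : Fin 3 → ℕ) q < d := fun q => (h' q).2.trans_lt (hlt q)
    rw [hval (x := x) (y := y) (z := z) (lt 0) (lt 1) (lt 2),
      hval (x := x') (y := y') (z := z') (lt' 0) (lt' 1) (lt' 2)]
    obtain ⟨p, hp⟩ := (shellBoxes d e hd he hev).exists_cell (i := i)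
      (X := ![⟨x, lt 0⟩, ⟨y, lt 1⟩, ⟨z, lt 2⟩]) (by
        intro q
        have := h q
        fin_cases q <;> exact this)
    obtain ⟨p', hp'⟩ := (shellBoxes d e hd he hev).exists_cell (i := i)
      (X := ![⟨x', lt' 0⟩, ⟨y', lt' 1⟩, ⟨z', lt' 2⟩]) (by
        intro q
        have := h' q
        fin_cases q <;> exact this)
    rw [← hp, ← hp']
    exact BoxFamily.apply_cell_eq _ hψ i p p'
  -- Orthogonality to the stopper: the coordinate sum of a product vector is the product of the
  -- factor sums.
  have hsum : (∑ x ∈ Finset.range (d - 1 + 1), a x) * (∑ x ∈ Finset.range (d - 1 + 1), b x) *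
      (∑ x ∈ Finset.range (d - 1 + 1), c x) = 0 := by
    rw [show d - 1 + 1 = d by omega, sum_coord, sum_coord, sum_coord,
      ← BoxFamily.sum_apply_eq_zero _ hψ]
    simp only [productVec]
    rw [← Fintype.prod_sum fun q x => v q x, Fin.prod_univ_three]
  have hvan := someVanishes_of_shellConst (d - 1) a b c
    (fun k hk => by
      have hk' : k < (d - 1) / 2 := by omega
      have hN : 2 ≤ d - 1 - 2 * k := by omega
      have key : ∀ β {x y z x' y' z'}, InShell (d - 1 - 2 * k) β x y z →
          InShell (d - 1 - 2 * k) β x' y' z' →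
          a (k + x) * b (k + y) * c (k + z) = a (k + x') * b (k + y') * c (k + z') :=
        fun β _ _ _ _ _ _ h h' => hconst (Sum.inl (⟨k, hk'⟩, β))
          (inShell_shift hd he hev hk' h) (inShell_shift hd he hev hk' h')
      exact
        { a₁ := fun x hx x' hx' z hz z' hz' => key (0, 0)
            ((inShell_a₁ hN).mpr ⟨hx.1, hx.2, rfl, hz⟩)
            ((inShell_a₁ hN).mpr ⟨hx'.1, hx'.2, rfl, hz'⟩)
          a₂ := fun x hx x' hx' y hy y' hy' => key (1, 0)
            ((inShell_a₂ hN).mpr ⟨hx.1, hx.2, hy, rfl⟩)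
            ((inShell_a₂ hN).mpr ⟨hx'.1, hx'.2, hy', rfl⟩)
          a₃ := fun y hy y' hy' z hz z' hz' => key (1, 1)
            ((inShell_a₃ hN).mpr ⟨rfl, hy.1, hy.2, hz⟩)
            ((inShell_a₃ hN).mpr ⟨rfl, hy'.1, hy'.2, hz'⟩)
          b₁ := fun x hx x' hx' z hz z' hz' => key (1, 2)
            ((inShell_b₁ hN).mpr ⟨hx, rfl, hz.1, hz.2⟩)
            ((inShell_b₁ hN).mpr ⟨hx', rfl, hz'.1, hz'.2⟩)
          b₂ := fun x hx x' hx' y hy y' hy' => key (0, 1)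
            ((inShell_b₂ hN).mpr ⟨hx, hy.1, hy.2, rfl⟩)
            ((inShell_b₂ hN).mpr ⟨hx', hy'.1, hy'.2, rfl⟩)
          b₃ := fun y hy y' hy' z hz z' hz' => key (0, 2)
            ((inShell_b₃ hN).mpr ⟨rfl, hy, hz.1, hz.2⟩)
            ((inShell_b₃ hN).mpr ⟨rfl, hy', hz'.1, hz'.2⟩) })
    (fun k hk x hx y hy z hz => by
      have hk' : k = (d - 2) / 2 := by omega
      refine hconst (Sum.inr ⟨0, hcenter (by omega)⟩) (fun q => ?_) (fun q => ?_) <;>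
        fin_cases q <;> simp [shellBoxes, ← hk'] <;> omega)
    hsum
  have hv : ∀ q : Fin 3, (∀ x ≤ d - 1, coord (v q) x = 0) → productVec v = 0 := by
    intro q hq
    ext X
    simp only [productVec]
    refine Finset.prod_eq_zero (Finset.mem_univ q) ?_
    have := hq (X q) (by have := (X q).2; omega)
    simpa [coord] using this
  rcases hvan with h | h | h
  · exact hne (hv 0 h)
  · exact hne (hv 1 h)
  · exact hne (hv 2 h)

theorem isUPB_shellBoxes (hcenter : d % 2 = 0 → 0 < e) :
    IsUPB (shellBoxes d e hd he hev).states := by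
  have : NeZero d := ⟨by omega⟩
  exact ⟨fun _ h => BoxFamily.states_isProductState _ h, BoxFamily.states_pairwise _,
    fun _ h => not_isProductState_of_mem_orthogonal hd he hev h hcenter⟩

end

end StrongUPB

/-! ### Strongest nonlocality -/

namespace StrongUPB

open BoxFamily (basisState allOnes)

section Gram

variable {d : ℕ} (T : Finset (Fin 3)) (M : LocalOp T d)

/-- `applyLocal` as a linear map. -/
noncomputable def applyLocalLinear : State (Fin 3) d →ₗ[ℂ] State (Fin 3) d where
  toFun := applyLocal T M
  map_add' ψ φ := by
    ext x
    simp [applyLocal, mul_add, Finset.sum_add_distrib]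
  map_smul' c ψ := by
    ext x
    simp [applyLocal, Finset.mul_sum, mul_left_comm]

/-- The Gram kernel of the images of the computational basis states. -/
noncomputable def gram (X Y : Fin 3 → Fin d) : ℂ :=
  inner ℂ (applyLocalLinear T M (basisState X)) (applyLocalLinear T M (basisState Y))

theorem updateOn_eq_iff (x X : Fin 3 → Fin d) (y : {p // p ∈ T} → Fin d) :
    updateOn T x y = X ↔ (∀ p ∉ T, x p = X p) ∧ y = fun p : {p // p ∈ T} => X p := by
  constructor
  · rintro rfl
    refine ⟨fun p hp => by simp [updateOn, hp], ?_⟩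
    funext p
    simp [updateOn]
  · rintro ⟨h, rfl⟩
    funext p
    by_cases hp : p ∈ T
    · simp [updateOn, hp]
    · simp [updateOn, hp, h p hp]

theorem applyLocalLinear_basisState (X x : Fin 3 → Fin d) :
    applyLocalLinear T M (basisState X) x =
      if ∀ p ∉ T, x p = X p then M (fun p => x p) (fun p => X p) else 0 := by
  simp only [applyLocalLinear, LinearMap.coe_mk, AddHom.coe_mk, applyLocal, basisState,
    PiLp.single_apply, updateOn_eq_iff]
  split_ifs with h
  · rw [Finset.sum_eq_single fun p : {p // p ∈ T} => X p, if_pos ⟨h, rfl⟩, mul_one]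
    · intro y _ hy
      rw [if_neg fun hc => hy hc.2, mul_zero]
    · exact fun hn => absurd (Finset.mem_univ _) hn
  · simp [h]

/-- The Gram kernel is the matrix of `M†M ⊗ 𝕀`. -/
theorem gram_eq (X Y : Fin 3 → Fin d) :
    gram T M X Y = if ∀ p ∉ T, X p = Y p then (Mᴴ * M) (fun p => X p) (fun p => Y p) else 0 := by
  simp only [gram, PiLp.inner_apply, applyLocalLinear_basisState]
  split_ifs with h
  · have h1 : ∀ x : Fin 3 → Fin d,
        inner ℂ (if ∀ p ∉ T, x p = X p then M (fun p => x p) (fun p => X p) else 0)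
          (if ∀ p ∉ T, x p = Y p then M (fun p => x p) (fun p => Y p) else 0) =
        if ∀ p ∉ T, x p = X p then
          conj (M (fun p => x p) (fun p => X p)) * M (fun p => x p) (fun p => Y p) else 0 := by
      intro x
      have hiff : (∀ p ∉ T, x p = Y p) ↔ ∀ p ∉ T, x p = X p :=
        forall₂_congr fun p hp => by rw [h p hp]
      simp only [hiff]
      split_ifs
      · simp [mul_comm]
      · simp
    simp only [h1]
    rw [← Finset.sum_filter, Matrix.mul_apply]
    refine Finset.sum_nbij' (fun x p => x p) (fun u => updateOn T X u) (fun _ _ => Finset.mem_univ _)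
      (fun u _ => ?_) (fun x hx => ?_) (fun u _ => ?_) (fun x _ => ?_)
    · simp +contextual [updateOn]
    · rw [Finset.mem_filter] at hx
      rw [updateOn_eq_iff]
      exact ⟨fun p hp => (hx.2 p hp).symm, rfl⟩
    · funext p
      simp [updateOn]
    · simp [Matrix.conjTranspose_apply]
  · refine Finset.sum_eq_zero fun x _ => ?_
    by_cases h1 : ∀ p ∉ T, x p = X p
    · rw [if_neg (c := ∀ p ∉ T, x p = Y p), inner_zero_right]
      exact fun h2 => h fun p hp => (h1 p hp).symm.trans (h2 p hp)
    · rw [if_neg h1, inner_zero_left]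

end Gram

section Coordinates

variable {d : ℕ} [NeZero d] (p₀ : Fin 3)

/-- The joint index with coordinates `x, y, z` at the parties `p₀, p₀ + 1, p₀ + 2`. -/
def cyclicIndex (x y z : ℕ) : Fin 3 → Fin d :=
  fun q => Fin.ofNat d ((![x, y, z] : Fin 3 → ℕ) (q - p₀))

theorem cyclicIndex_self (X : Fin 3 → Fin d) :
    cyclicIndex p₀ (X p₀) (X (p₀ + 1)) (X (p₀ + 2)) = X := by
  funext q
  obtain ⟨q', rfl⟩ : ∃ q', q = p₀ + q' := ⟨q - p₀, by abel⟩
  simp only [cyclicIndex, add_sub_cancel_left]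
  fin_cases q' <;> simp

theorem sum_cyclicIndex (F : (Fin 3 → Fin d) → ℂ) :
    ∑ Y, F Y = ∑ x ∈ Finset.range d, ∑ y ∈ Finset.range d, ∑ z ∈ Finset.range d,
      F (cyclicIndex p₀ x y z) := by
  simp only [← Finset.sum_product']
  symm
  refine Finset.sum_nbij' (fun t => cyclicIndex p₀ t.1 t.2.1 t.2.2)
    (fun Y => (Y p₀, Y (p₀ + 1), Y (p₀ + 2))) (fun _ _ => Finset.mem_univ _) (fun Y _ => ?_)
    (fun t ht => ?_) (fun Y _ => cyclicIndex_self p₀ Y) (fun _ _ => rfl)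
  · simp
  · obtain ⟨x, y, z⟩ := t
    simp only [Finset.mem_product, Finset.mem_range] at ht
    simp [cyclicIndex, Nat.mod_eq_of_lt, ht]

end Coordinates

section Kernel

variable {d : ℕ} [NeZero d] (p₀ : Fin 3) (T : Finset (Fin 3)) (M : LocalOp T d)

/-- The Gram kernel restricted to the parties other than `p₀`. -/
noncomputable def gramKernel (y z y' z' : ℕ) : ℂ :=
  gram T M (cyclicIndex p₀ 0 y z) (cyclicIndex p₀ 0 y' z')

/-- Since `p₀` is not measured, its coordinate enters only through an identity factor. One kernel in
two coordinates thus treats `T` of size one and two alike. -/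
theorem gram_cyclicIndex (hp₀ : p₀ ∉ T) {x x' : ℕ} (hx : x < d) (hx' : x' < d) (y z y' z' : ℕ) :
    gram T M (cyclicIndex p₀ x y z) (cyclicIndex p₀ x' y' z') =
      extendKernel (gramKernel p₀ T M) x y z x' y' z' := by
  have self : ∀ x y z, (cyclicIndex p₀ x y z : Fin 3 → Fin d) p₀ = Fin.ofNat d x := by
    intro x y z
    simp [cyclicIndex]
  have other : ∀ x y z p, p ≠ p₀ →
      (cyclicIndex p₀ x y z : Fin 3 → Fin d) p = cyclicIndex p₀ 0 y z p := by
    intro x y z p hp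
    obtain ⟨q', rfl⟩ : ∃ q', p = p₀ + q' := ⟨p - p₀, by abel⟩
    simp only [cyclicIndex, add_sub_cancel_left]
    fin_cases q'
    · simp at hp
    · rfl
    · rfl
  rw [extendKernel]
  split_ifs with h
  · subst h
    rw [gramKernel, gram_eq, gram_eq]
    have r : ∀ x y z, (fun p : {p // p ∈ T} => (cyclicIndex p₀ x y z : Fin 3 → Fin d) p) =
        fun p : {p // p ∈ T} => cyclicIndex p₀ 0 y z p := by
      intro x y z
      funext p
      exact other x y z p fun h => hp₀ (h ▸ p.2)
    rw [r x y z, r x y' z']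
    refine if_congr (forall₂_congr fun p hp => ?_) rfl rfl
    by_cases hpp : p = p₀
    · subst hpp
      simp [self]
    · rw [other x y z p hpp, other x y' z' p hpp]
  · rw [gram_eq, if_neg]
    intro hall
    have := congrArg Fin.val (hall p₀ hp₀)
    rw [self, self] at this
    simp only [Fin.val_ofNat, Nat.mod_eq_of_lt hx, Nat.mod_eq_of_lt hx'] at this
    exact h this

end Kernel

section Ortho

/-- The outermost box with label `β`, rotated by `p₀`. -/
def outerBox {d : ℕ} (hd : 3 ≤ d) (e : ℕ) (p₀ : Fin 3) (β : Fin 2 × Fin 3) :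
    (Fin ((d - 1) / 2) × Fin 2 × Fin 3) ⊕ Fin e :=
  Sum.inl (⟨0, by omega⟩, β.1, β.2 + p₀)

variable {d e : ℕ} (hd : 3 ≤ d) (he : e ≤ 1) (hev : 0 < e → d % 2 = 0)

theorem outerBox_injective (p₀ : Fin 3) : Function.Injective (outerBox hd e p₀) := by
  rintro ⟨σ, r⟩ ⟨σ', r'⟩ h
  simpa [outerBox, Sum.inl.injEq, Prod.mk.injEq] using h

theorem exists_cell_outerBox [NeZero d] (p₀ : Fin 3) {β : Fin 2 × Fin 3} {x y z : ℕ}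
    (h : InShell (d - 1) β x y z) :
    ∃ p, (shellBoxes d e hd he hev).cell (outerBox hd e p₀ β) p = cyclicIndex p₀ x y z := by
  obtain ⟨σ, r⟩ := β
  refine BoxFamily.exists_cell _ fun q => ?_
  have hlt := (shellBoxes d e hd he hev).lt (outerBox hd e p₀ (σ, r)) q
  have hq := h (q - p₀)
  simp only [show d - 1 + 1 = d by omega] at hq
  simp only [outerBox, shellBoxes, Sum.elim_inl, show q - (r + p₀) = q - p₀ - r by abel] at hlt ⊢
  simp only [cyclicIndex, Fin.val_ofNat]
  rw [Nat.mod_eq_of_lt (by omega)]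
  exact hq

/-- The position with given coordinates, reduced modulo the side lengths of the box. -/
def posOfNat {κ ι : Type} {d : ℕ} (B : BoxFamily κ ι d) (i : ι) (f : κ → ℕ) : B.Pos i :=
  fun q => Fin.ofNat _ (f q)

theorem posOfNat_add {κ ι : Type} {d : ℕ} (B : BoxFamily κ ι d) (i : ι) (f g : κ → ℕ) :
    posOfNat B i f + posOfNat B i g = posOfNat B i (f + g) := by
  funext q
  simp [posOfNat, Fin.ext_iff, Fin.val_add]

theorem cell_posOfNat [NeZero d] (p₀ : Fin 3) {β : Fin 2 × Fin 3} {x y z : ℕ} (f : Fin 3 → ℕ)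
    (h : ∀ q, baseLo d 0 β.1 (q - β.2) + f q % (baseLen d 0 β.1 (q - β.2) + 1) =
      (![x, y, z] : Fin 3 → ℕ) q) :
    (shellBoxes d e hd he hev).cell (outerBox hd e p₀ β)
      (posOfNat _ _ fun q => f (q - p₀)) = cyclicIndex p₀ x y z := by
  obtain ⟨σ, r⟩ := β
  funext q
  have hlt := (shellBoxes d e hd he hev).lt (outerBox hd e p₀ (σ, r)) q
  have hq := h (q - p₀)
  simp only [outerBox, shellBoxes, Sum.elim_inl, show q - (r + p₀) = q - p₀ - r by abel] at hlt
  have hmod := Nat.mod_lt (f (q - p₀)) (Nat.succ_pos (baseLen d 0 σ (q - p₀ - r)))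
  simp only [Nat.succ_eq_add_one] at hmod
  refine Fin.ext ?_
  simp only [BoxFamily.cell, posOfNat, cyclicIndex, Fin.val_ofNat]
  rw [← hq, Nat.mod_eq_of_lt (a := _ + _) (by simp only; omega)]
  simp only [outerBox, shellBoxes, Sum.elim_inl, show q - (r + p₀) = q - p₀ - r by abel]

theorem inner_map_sub_sub {T : Finset (Fin 3)} (M : LocalOp T d) (X X₀ Y Y₀ : Fin 3 → Fin d) :
    inner ℂ (applyLocalLinear T M (basisState X - basisState X₀))
      (applyLocalLinear T M (basisState Y - basisState Y₀)) =
    gram T M X Y - gram T M X₀ Y - gram T M X Y₀ + gram T M X₀ Y₀ := by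
  simp only [map_sub, inner_sub_left, inner_sub_right, gram]
  ring

/-- The outer boxes are permuted by cyclic rotation, so any `p₀` can play the role of the first
party, and the three Gram relations of `BoxFamily` become the fields of `OrthoKernel`. -/
theorem orthoKernel_gramKernel [NeZero d] (p₀ : Fin 3) {T : Finset (Fin 3)} (hp₀ : p₀ ∉ T)
    (M : LocalOp T d)
    (hM : (shellBoxes d e hd he hev).states.Pairwise fun ψ φ =>
      inner ℂ (applyLocal T M ψ) (applyLocal T M φ) = 0) :
    OrthoKernel (d - 1) (gramKernel p₀ T M) := by
  have hN : 2 ≤ d - 1 := by omega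
  have hL : (shellBoxes d e hd he hev).states.Pairwise fun ψ φ =>
      inner ℂ (applyLocalLinear T M ψ) (applyLocalLinear T M φ) = 0 := hM
  have lt_of_mem : ∀ {β x y z}, InShell (d - 1) β x y z → x < d := by
    intro β x y z h
    have h0 := h 0
    have hlt := (shellBoxes d e hd he hev).lt (outerBox hd e 0 β) 0
    simp only [show d - 1 + 1 = d by omega] at h0
    simp only [outerBox, shellBoxes, Sum.elim_inl, add_zero] at hlt
    exact h0.2.trans_lt hlt
  have sum_gram : ∀ {x : ℕ}, x < d → ∀ y z,
      ∑ Y, gram T M (cyclicIndex p₀ x y z) Y = ∑ y' ∈ Finset.range (d - 1 + 1),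
        ∑ z' ∈ Finset.range (d - 1 + 1), gramKernel p₀ T M y z y' z' := by
    intro x hx y z
    rw [sum_cyclicIndex p₀, Finset.sum_eq_single x, show d - 1 + 1 = d by omega]
    · refine Finset.sum_congr rfl fun y' _ => Finset.sum_congr rfl fun z' _ => ?_
      rw [gram_cyclicIndex p₀ T M hp₀ hx hx, extendKernel, if_pos rfl]
    · intro x' hx' hne
      refine Finset.sum_eq_zero fun y' _ => Finset.sum_eq_zero fun z' _ => ?_
      rw [gram_cyclicIndex p₀ T M hp₀ hx (Finset.mem_range.mp hx'), extendKernel, if_neg hne.symm]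
    · intro h
      exact absurd (Finset.mem_range.mpr hx) h
  have sum_gram' : ∀ {x : ℕ}, x < d → ∀ y z,
      ∑ Y, gram T M Y (cyclicIndex p₀ x y z) = ∑ y' ∈ Finset.range (d - 1 + 1),
        ∑ z' ∈ Finset.range (d - 1 + 1), gramKernel p₀ T M y' z' y z := by
    intro x hx y z
    rw [sum_cyclicIndex p₀, Finset.sum_eq_single x, show d - 1 + 1 = d by omega]
    · refine Finset.sum_congr rfl fun y' _ => Finset.sum_congr rfl fun z' _ => ?_
      rw [gram_cyclicIndex p₀ T M hp₀ hx hx, extendKernel, if_pos rfl]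
    · intro x' hx' hne
      refine Finset.sum_eq_zero fun y' _ => Finset.sum_eq_zero fun z' _ => ?_
      rw [gram_cyclicIndex p₀ T M hp₀ (Finset.mem_range.mp hx') hx, extendKernel, if_neg hne]
    · intro h
      exact absurd (Finset.mem_range.mpr hx) h
  -- In a box that is flat along `p₀` all cells have the same `p₀`-coordinate, so the factor
  -- `δ_{xx'}` is always `1` and shift invariance passes to the kernel itself.
  have shift : ∀ (β : Fin 2 × Fin 3) (lo len : Fin 3 → ℕ), (∀ q, baseLo d 0 β.1 (q - β.2) = lo q) →
      (∀ q, baseLen d 0 β.1 (q - β.2) = len q) → lo 0 < d → len 0 = 0 →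
      ∀ ρ ρ' s t s₀ t₀ a b a₀ b₀,
      altSum (gramKernel p₀ T M)
        (lo 1 + (s + ρ) % (len 1 + 1)) (lo 2 + (t + ρ') % (len 2 + 1))
        (lo 1 + (s₀ + ρ) % (len 1 + 1)) (lo 2 + (t₀ + ρ') % (len 2 + 1))
        (lo 1 + (a + ρ) % (len 1 + 1)) (lo 2 + (b + ρ') % (len 2 + 1))
        (lo 1 + (a₀ + ρ) % (len 1 + 1)) (lo 2 + (b₀ + ρ') % (len 2 + 1)) =
      altSum (gramKernel p₀ T M) (lo 1 + s % (len 1 + 1)) (lo 2 + t % (len 2 + 1))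
        (lo 1 + s₀ % (len 1 + 1)) (lo 2 + t₀ % (len 2 + 1))
        (lo 1 + a % (len 1 + 1)) (lo 2 + b % (len 2 + 1))
        (lo 1 + a₀ % (len 1 + 1)) (lo 2 + b₀ % (len 2 + 1)) := by
    intro β lo len hlo hlen hlo0 hlen0 ρ ρ' s t s₀ t₀ a b a₀ b₀
    set B := shellBoxes d e hd he hev with hB
    let pos : ℕ → ℕ → B.Pos (outerBox hd e p₀ β) := fun s t =>
      posOfNat B _ fun q => (![0, s, t] : Fin 3 → ℕ) (q - p₀)
    have pos_add : ∀ s t, pos s t + pos ρ ρ' = pos (s + ρ) (t + ρ') := by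
      intro s t
      simp only [pos, posOfNat_add]
      congr 1
      funext q
      simp only [Pi.add_apply]
      generalize q - p₀ = q'
      fin_cases q' <;> rfl
    have cell_pos : ∀ s t, B.cell _ (pos s t) = cyclicIndex p₀ (lo 0)
        (lo 1 + s % (len 1 + 1)) (lo 2 + t % (len 2 + 1)) := by
      intro s t
      refine cell_posOfNat hd he hev p₀ ![0, s, t] fun q => ?_
      rw [hlo, hlen]
      fin_cases q <;> simp
    have key := B.inner_map_sub_add (applyLocalLinear T M) hL _ (pos ρ ρ') (pos s t) (pos s₀ t₀)
      (pos a b) (pos a₀ b₀)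
    simpa only [pos_add, cell_pos, inner_map_sub_sub, gram_cyclicIndex p₀ T M hp₀ hlo0 hlo0,
      extendKernel, if_true, altSum] using key
  refine ⟨?_, ?_, ?_, ?_, ?_⟩
  · intro β β' hβ x y z x₀ y₀ z₀ a b c a₀ b₀ c₀ h1 h2 h3 h4
    obtain ⟨p, hp⟩ := exists_cell_outerBox hd he hev p₀ h1
    obtain ⟨p', hp'⟩ := exists_cell_outerBox hd he hev p₀ h2
    obtain ⟨q, hq⟩ := exists_cell_outerBox hd he hev p₀ h3
    obtain ⟨q', hq'⟩ := exists_cell_outerBox hd he hev p₀ h4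
    have key := BoxFamily.inner_map_sub_of_ne _ _ hL
      (fun h => hβ (outerBox_injective hd p₀ h)) p p' q q'
    have l1 := lt_of_mem h1
    have l2 := lt_of_mem h2
    have l3 := lt_of_mem h3
    have l4 := lt_of_mem h4
    rwa [hp, hp', hq, hq', inner_map_sub_sub, gram_cyclicIndex p₀ T M hp₀ l1 l3,
      gram_cyclicIndex p₀ T M hp₀ l2 l3, gram_cyclicIndex p₀ T M hp₀ l1 l4,
      gram_cyclicIndex p₀ T M hp₀ l2 l4] at key
  · intro β x y z x₀ y₀ z₀ h1 h2
    obtain ⟨p, hp⟩ := exists_cell_outerBox hd he hev p₀ h1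
    obtain ⟨p', hp'⟩ := exists_cell_outerBox hd he hev p₀ h2
    have key := BoxFamily.inner_map_sub_allOnes _ _ hL _ p p'
    rw [hp, hp', map_sub, inner_sub_left, allOnes, map_sum, inner_sum, inner_sum, sub_eq_zero] at key
    rw [← sum_gram (lt_of_mem h1), ← sum_gram (lt_of_mem h2)]
    exact key
  · intro β x y z x₀ y₀ z₀ h1 h2
    obtain ⟨p, hp⟩ := exists_cell_outerBox hd he hev p₀ h1
    obtain ⟨p', hp'⟩ := exists_cell_outerBox hd he hev p₀ h2
    have key := inner_eq_zero_symm.mp (BoxFamily.inner_map_sub_allOnes _ _ hL _ p p')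
    rw [hp, hp', map_sub, inner_sub_right, allOnes, map_sum, sum_inner, sum_inner, sub_eq_zero] at key
    rw [← sum_gram' (lt_of_mem h1), ← sum_gram' (lt_of_mem h2)]
    exact key
  · intro ρ ρ' s t s₀ t₀ a b a₀ b₀ hs ht hs₀ ht₀ ha hb ha₀ hb₀
    -- The flat box at height `d - 1`, over `[1, N] × [0, N-1]`.
    have key := shift (1, 1) ![d - 1, 1, 0] ![0, d - 2, d - 2]
      (by intro q; fin_cases q <;> rfl) (by intro q; fin_cases q <;> rfl)
      (by simp; omega) rfl ρ ρ' s t s₀ t₀ a b a₀ b₀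
    simpa [show d - 2 + 1 = d - 1 by omega, Nat.mod_eq_of_lt, hs, ht, hs₀, ht₀, ha, hb, ha₀, hb₀]
      using key
  · intro ρ ρ' s t s₀ t₀ a b a₀ b₀ hs ht hs₀ ht₀ ha hb ha₀ hb₀
    -- The flat box at height `0`, over `[0, N-1] × [1, N]`.
    have key := shift (0, 2) ![0, 0, 1] ![0, d - 2, d - 2]
      (by intro q; fin_cases q <;> rfl) (by intro q; fin_cases q <;> rfl)
      (by simp; omega) rfl ρ ρ' s t s₀ t₀ a b a₀ b₀
    simpa [show d - 2 + 1 = d - 1 by omega, Nat.mod_eq_of_lt, hs, ht, hs₀, ht₀, ha, hb, ha₀, hb₀]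
      using key

theorem hasStrongestNonlocality_shellBoxes :
    HasStrongestNonlocality (shellBoxes d e hd he hev).states := by
  have : NeZero d := ⟨by omega⟩
  intro T _ hT r M _ hM m
  obtain ⟨p₀, hp₀⟩ : ∃ p₀, p₀ ∉ T := by
    by_contra h
    push Not at h
    exact hT (Finset.eq_univ_of_forall h)
  obtain ⟨c, hc⟩ := (orthoKernel_gramKernel hd he hev p₀ hp₀ (M m) (hM m)).rigid (by omega)
  refine ⟨c, ?_⟩
  ext u u'
  -- Indices of `T` are extended by `0`. The two extensions then agree outside `T`, so the Gram
  -- kernel returns exactly the entry of `M†M`.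
  let ext : ({p // p ∈ T} → Fin d) → Fin 3 → Fin d := fun u p => if h : p ∈ T then u ⟨p, h⟩ else 0
  have hext : ∀ u, (fun p : {p // p ∈ T} => ext u p) = u := by
    intro u
    funext p
    simp [ext]
  have ext0 : ∀ u, ext u p₀ = 0 := by
    intro u
    simp [ext, hp₀]
  have hgram : gram T (M m) (ext u) (ext u') = ((M m)ᴴ * M m) u u' := by
    rw [gram_eq, if_pos, hext, hext]
    intro p hp
    simp [ext, hp]
  have hcyc : ∀ u, cyclicIndex p₀ 0 (ext u (p₀ + 1)) (ext u (p₀ + 2)) = ext u := by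
    intro u
    have := cyclicIndex_self p₀ (ext u)
    rwa [ext0, Fin.val_zero] at this
  have hker := hc.eq_scalar (by omega) (y := ext u (p₀ + 1)) (z := ext u (p₀ + 2))
    (y' := ext u' (p₀ + 1)) (z' := ext u' (p₀ + 2)) (by omega) (by omega) (by omega) (by omega)
  rw [gramKernel, hcyc, hcyc, hgram] at hker
  rw [hker, Matrix.smul_apply, Matrix.one_apply, smul_eq_mul, mul_ite, mul_one, mul_zero]
  refine if_congr ⟨fun h => ?_, ?_⟩ rfl rfl
  · rw [← hext u, ← hext u', ← hcyc u, ← hcyc u', h.1, h.2]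
  · rintro rfl
    exact ⟨rfl, rfl⟩

end Ortho

end StrongUPB

theorem theorem1 (d : ℕ) (hd : 3 ≤ d) :
    (Odd d →
      StrongUPB.IsUPB (StrongUPB.oddSet d) ∧
      StrongUPB.HasStrongestNonlocality (StrongUPB.oddSet d) ∧
      (StrongUPB.oddSet d).Finite ∧
      ((StrongUPB.oddSet d).ncard : ℤ) = (d : ℤ) ^ 3 - 4 * d + 4) ∧
    (Even d →
      StrongUPB.IsUPB (StrongUPB.evenSet d) ∧
      StrongUPB.HasStrongestNonlocality (StrongUPB.evenSet d) ∧
      (StrongUPB.evenSet d).Finite ∧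
      ((StrongUPB.evenSet d).ncard : ℤ) = (d : ℤ) ^ 3 - 4 * d + 8) := by
  constructor
  · intro hodd
    have hmod : d % 2 = 1 := Nat.odd_iff.mp hodd
    rw [StrongUPB.oddSet_eq_states hd hmod]
    refine ⟨StrongUPB.isUPB_shellBoxes _ _ _ (by omega),
      StrongUPB.hasStrongestNonlocality_shellBoxes _ _ _, StrongUPB.BoxFamily.states_finite _, ?_⟩
    rw [StrongUPB.ncard_shellBoxes]
    obtain ⟨K, rfl⟩ : ∃ K, d = 2 * K + 1 := ⟨d / 2, by omega⟩
    rw [show (2 * K + 1 - 1) / 2 = K by omega, (StrongUPB.sum_shell_card K).1]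
    push_cast
    ring
  · intro heven
    have hmod : d % 2 = 0 := Nat.even_iff.mp heven
    rw [StrongUPB.evenSet_eq_states hd hmod]
    refine ⟨StrongUPB.isUPB_shellBoxes _ _ _ fun _ => one_pos,
      StrongUPB.hasStrongestNonlocality_shellBoxes _ _ _, StrongUPB.BoxFamily.states_finite _, ?_⟩
    rw [StrongUPB.ncard_shellBoxes]
    obtain ⟨K, rfl⟩ : ∃ K, d = 2 * K + 2 := ⟨d / 2 - 1, by omega⟩
    rw [show (2 * K + 2 - 1) / 2 = K by omega, (StrongUPB.sum_shell_card K).2]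
    push_cast
    ring
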